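/- Conventions. Let $(M,L)$ be a Finsler manifold of dimension $n$: $L\colon TM\to\mathbb R$ is continuous, vanishes exactly on the zero section, is positive and $C^\infty$ off the zero section, positively homogeneous of degree one in $y$, and $g_{ij}=\tfrac12\,\partial^2L^2/\partial y^i\partial y^j$ is positive definite for $y\ne0$. A $\pi$-tensor is a tensor field on the pullback of $TM$ to the slit tangent bundle $TM\setminus 0$. Let $\nabla$ be the Cartan connection, $\beta$ its horizontal lift, $\overset{h}{\nabla}$ its horizontal covariant derivative, and $\eta=y^i\partial_i$. Write $$R(X,Y)Z=-\nabla_{\beta X}\nabla_{\beta Y}Z+\nabla_{\beta Y}\nabla_{\beta X}Z+\nabla_{[\beta X,\beta Y]}Z,\qquad \widehat R(X,Y)=R(X,Y)\eta,$$ $$\mathrm{Ric}(X,Y)=\mathrm{Tr}\{Z\mapsto R(X,Z)Y\},\qquad r=\mathrm{Tr}_g\,\mathrm{Ric},$$ $$G(X,Y)Z=g(X,Z)Y-g(Y,Z)X,\qquad C=R-\tfrac{r}{n(n-1)}G .$$ "Non-zero" always means "not identically zero". One-forms (two-forms) below are $C^\infty$ scalar $\pi$-tensors of type $(0,1)$ (of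 type $(0,2)$, not necessarily alternating) on $TM\setminus0$ that are positively homogeneous of degree zero in $y$. For a $\pi$-one-form $B$, $\overset{h}{\nabla}B$ has components $B_{i|j}=(\nabla_{\delta_j}B)(\partial_i)$, where $\delta_j=\beta\partial_j$, and $A\otimes B$ has components $A_iB_j$. An equation $\overset{h}{\nabla}T=A\otimes T+\cdots$ means $T_{|i}=A_iT+\cdots$, and $\overset{h}{\nabla}\overset{h}{\nabla}T=\alpha\otimes T+\cdots$ means $T_{|i|j}=\alpha_{ij}T+\cdots$. For $n\ge3$, $(M,L)$ is called - recurrent ($F_n$) if $R\neq0$ and $\overset{h}{\nabla}R=A\otimes R$ for some one-form $A\ne0$; - generalized recurrent with recurrence forms $A,B$ if $R\ne0$ and $\overset{h}{\nabla}R=A\otimes R+B\otimes G$ with one-forms $A\neq0$, $B\ne0$; - generalized 2-recurrent ($G(2F_n)$) if $R\ne0$ and $\overset{h}{\nabla}\overset{h}{\nabla}R=\alpha\otimes R+\mu\otimes G$ for some two-forms $\alpha\ne0$, $\mu\neq0$; - generalized Ricci recurrent ($GRF_n$) if $\mathrm{Ric}\ne0$ and $\overset{h}{\nabla}\mathrm{Ric}=A\otimes\mathrm{Ric}+B\otimes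 g$ for some one-forms $A\neq0$, $B\neq0$; - concircularly recurrent ($CF_n$) if $C\ne0$ and $\overset{h}{\nabla}C=A\otimes C$ for some one-form $A\ne0$; - 2-concircularly recurrent ($2CF_n$) if $C\neq0$ and $\overset{h}{\nabla}\overset{h}{\nabla}C=\alpha\otimes C$ for some two-form $\alpha\ne0$. **Theorem.** Let $(M,L)$ be a generalized recurrent Finsler manifold of dimension $n\ge3$ with recurrence forms $A$ and $B$. Then: (a) $(M,L)$ is generalized 2-recurrent, provided that $\overset{h}{\nabla}A+A\otimes A\neq0$ and $\overset{h}{\nabla}B+A\otimes B\ne0$. (b) $(M,L)$ is concircularly recurrent, provided that $C\neq 0$ and $r\ne0$. (c) $(M,L)$ is 2-concircularly recurrent, provided that $C\neq0$, $\overset{h}{\nabla}A+A\otimes A\ne0$ and $r\ne0$. (d) $(M,L)$ is generalized Ricci recurrent. (e) $(M,L)$ is recurrent, provided that $\widehat R=0$ and $r\ne0$. -/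

import Mathlib

open scoped Manifold ContDiff

noncomputable section

/-! ### Finsler geometry in a chart

A point `p = (x, y)` consists of the coordinates `x` of a point of the manifold and the components
`y` of a tangent vector there. All functions below are meant on the set where `y ≠ 0`.
In this part `L : ChartPt n → ℝ` is the coordinate expression of the Finsler function. -/

/-- Coordinates `(x, y)` on the tangent bundle over a chart domain. -/
abbrev ChartPt (n : ℕ) : Type := EuclideanSpace ℝ (Fin n) × EuclideanSpace ℝ (Fin n)

namespace ChartFinsler

variable {n : ℕ}

/-- The partial derivative `∂f/∂xⁱ`. -/
def pdx (i : Fin n) (f : ChartPt n → ℝ) (p : ChartPt n) : ℝ :=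
  fderiv ℝ f p (EuclideanSpace.single i 1, 0)

/-- The partial derivative `∂f/∂yⁱ`. -/
def pdy (i : Fin n) (f : ChartPt n → ℝ) (p : ChartPt n) : ℝ :=
  fderiv ℝ f p (0, EuclideanSpace.single i 1)

/-- The Finsler metric `g_{ij} = ½ ∂²L²/∂yⁱ∂yʲ`. -/
def metric (L : ChartPt n → ℝ) (i j : Fin n) (p : ChartPt n) : ℝ :=
  (1 / 2) * pdy i (pdy j (fun q => L q ^ 2)) p

/-- The matrix `(g_{ij})` at a point. -/
def metricMatrix (L : ChartPt n → ℝ) (p : ChartPt n) : Matrix (Fin n) (Fin n) ℝ :=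
  Matrix.of fun i j => metric L i j p

/-- The inverse metric `gⁱʲ`. -/
def invMetric (L : ChartPt n → ℝ) (i j : Fin n) (p : ChartPt n) : ℝ :=
  (metricMatrix L p)⁻¹ i j

/-- The coefficients of the canonical spray,
`Gⁱ = ¼ gⁱˡ (yᵏ ∂²L²/∂xᵏ∂yˡ - ∂L²/∂xˡ)`. -/
def spray (L : ChartPt n → ℝ) (i : Fin n) (p : ChartPt n) : ℝ :=
  (1 / 4) * ∑ l, invMetric L i l p *
    ((∑ k, p.2 k * pdx k (pdy l (fun q => L q ^ 2)) p) - pdx l (fun q => L q ^ 2) p)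

/-- The coefficients `Nⁱ_j = ∂Gⁱ/∂yʲ` of the nonlinear connection. -/
def nonlin (L : ChartPt n → ℝ) (i j : Fin n) (p : ChartPt n) : ℝ :=
  pdy j (spray L i) p

/-- The derivative `δ_j f = ∂f/∂xʲ - Nᵐ_j ∂f/∂yᵐ` along the `j`-th basic horizontal vector field
`β(∂_j) = δ_j`. -/
def hpd (L : ChartPt n → ℝ) (j : Fin n) (f : ChartPt n → ℝ) (p : ChartPt n) : ℝ :=
  pdx j f p - ∑ m, nonlin L m j p * pdy m f p

/-- The horizontal coefficients of the Cartan connection, `∇_{δ_j} ∂_k = Γⁱ_{jk} ∂_i`, where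
`Γⁱ_{jk} = ½ gⁱˡ (δ_j g_{lk} + δ_k g_{lj} - δ_l g_{jk})`. -/
def hCoeff (L : ChartPt n → ℝ) (i j k : Fin n) (p : ChartPt n) : ℝ :=
  (1 / 2) * ∑ l, invMetric L i l p *
    (hpd L j (metric L l k) p + hpd L k (metric L l j) p - hpd L l (metric L j k) p)

/-- The vertical coefficients of the Cartan connection, `∇_{∂/∂yʲ} ∂_k = Cⁱ_{jk} ∂_i`, where
`Cⁱ_{jk} = ½ gⁱˡ ∂g_{lk}/∂yʲ`. -/
def vCoeff (L : ChartPt n → ℝ) (i j k : Fin n) (p : ChartPt n) : ℝ :=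
  (1 / 2) * ∑ l, invMetric L i l p * pdy j (metric L l k) p

/-- Components of a π-tensor field of type `(1, 3)`: `T i j k l` is the `i`-th component of
`T(∂_k, ∂_l)∂_j`. -/
abbrev Tensor13 (n : ℕ) : Type := Fin n → Fin n → Fin n → Fin n → ChartPt n → ℝ

/-- The horizontal curvature tensor of the Cartan connection
`R(X, Y)Z = -∇_{βX}∇_{βY}Z + ∇_{βY}∇_{βX}Z + ∇_{[βX, βY]}Z`; recall that
`[δ_k, δ_l] = (δ_l Nᵐ_k - δ_k Nᵐ_l) ∂/∂yᵐ`. -/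
def hCurv (L : ChartPt n → ℝ) : Tensor13 n := fun i j k l p =>
  hpd L l (hCoeff L i k j) p - hpd L k (hCoeff L i l j) p
    + (∑ m, hCoeff L i l m p * hCoeff L m k j p)
    - (∑ m, hCoeff L i k m p * hCoeff L m l j p)
    + ∑ m, vCoeff L i m j p * (hpd L l (nonlin L m k) p - hpd L k (nonlin L m l) p)

/-- The contracted curvature `R̂(X, Y) = R(X, Y)η`, with `η = yʲ ∂_j`. -/
def hCurvHat (L : ChartPt n → ℝ) (i k l : Fin n) (p : ChartPt n) : ℝ :=
  ∑ j, hCurv L i j k l p * p.2 j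

/-- The tensor `G(X, Y)Z = g(X, Z)Y - g(Y, Z)X`. -/
def tensorG (L : ChartPt n → ℝ) : Tensor13 n := fun i j k l p =>
  metric L k j p * (if i = l then 1 else 0) - metric L l j p * (if i = k then 1 else 0)

/-- The horizontal Ricci tensor `Ric(X, Y) = Tr(Z ↦ R(X, Z)Y)`, with components
`ricci j k = Ric(∂_j, ∂_k)`. -/
def ricci (L : ChartPt n → ℝ) (j k : Fin n) (p : ChartPt n) : ℝ :=
  ∑ i, hCurv L i k j i p

/-- The horizontal scalar curvature, the `g`-trace of the Ricci tensor. -/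
def scalarCurv (L : ChartPt n → ℝ) (p : ChartPt n) : ℝ :=
  ∑ j, ∑ k, invMetric L j k p * ricci L j k p

/-- The concircular curvature tensor `C = R - (r / (n(n-1))) G`. -/
def concircular (L : ChartPt n → ℝ) : Tensor13 n := fun i j k l p =>
  hCurv L i j k l p - scalarCurv L p / ((n : ℝ) * ((n : ℝ) - 1)) * tensorG L i j k l p

/-- Horizontal covariant derivative of a π-one-form: `a_{i|m} = (∇_{δ_m} a)(∂_i)`. -/
def hCov1 (L : ChartPt n → ℝ) (a : Fin n → ChartPt n → ℝ) (i m : Fin n) (p : ChartPt n) : ℝ :=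
  hpd L m (a i) p - ∑ s, hCoeff L s m i p * a s p

/-- Horizontal covariant derivative of a π-tensor of type `(0, 2)`:
`T_{ij|m} = (∇_{δ_m} T)(∂_i, ∂_j)`. -/
def hCov2 (L : ChartPt n → ℝ) (T : Fin n → Fin n → ChartPt n → ℝ) (i j m : Fin n)
    (p : ChartPt n) : ℝ :=
  hpd L m (T i j) p - (∑ s, hCoeff L s m i p * T s j p) - ∑ s, hCoeff L s m j p * T i s p

/-- Horizontal covariant derivative of a π-tensor of type `(1, 3)`: the components of
`T_{|m} = ∇_{δ_m} T`. -/
def hCov13 (L : ChartPt n → ℝ) (T : Tensor13 n) (m : Fin n) : Tensor13 n := fun i j k l p =>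
  hpd L m (T i j k l) p + (∑ s, hCoeff L i m s p * T s j k l p)
    - (∑ s, hCoeff L s m j p * T i s k l p) - (∑ s, hCoeff L s m k p * T i j s l p)
    - ∑ s, hCoeff L s m l p * T i j k s p

/-- Second horizontal covariant derivative of a π-tensor of type `(1, 3)`: the components of
`T_{|m|q} = (∇_{δ_q} (∇T))(∂_m)`, the horizontal covariant derivative in direction `δ_q` of the
tensor `T_{|m}`, in which also the index `m` is tensorial. -/
def hCov13Second (L : ChartPt n → ℝ) (T : Tensor13 n) (m q : Fin n) : Tensor13 n :=
  fun i j k l p =>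
    hCov13 L (hCov13 L T m) q i j k l p - ∑ s, hCoeff L s q m p * hCov13 L T s i j k l p

end ChartFinsler

/-! ### Finsler manifolds -/

section Manifold

variable {n : ℕ} {M : Type*} [TopologicalSpace M] [ChartedSpace (EuclideanSpace ℝ (Fin n)) M]
  [IsManifold (𝓡 n) ∞ M]

/-- The tangent vector with base point coordinates `p.1` and components `p.2` in the chart `φ`. -/
def chartVec (φ : OpenPartialHomeomorph M (EuclideanSpace ℝ (Fin n))) (p : ChartPt n) :
    TangentBundle (𝓡 n) M :=
  ⟨φ.symm p.1, mfderiv (𝓡 n) (𝓡 n) φ.symm p.1 p.2⟩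

/-- The coordinate vector `∂_i` of the chart `φ`, at the base point with coordinates `p.1`,
as an element of the fibre of the pullback bundle over `chartVec φ p`. -/
def chartBasisVec (φ : OpenPartialHomeomorph M (EuclideanSpace ℝ (Fin n))) (p : ChartPt n)
    (i : Fin n) : TangentSpace (𝓡 n) (chartVec φ p).1 :=
  mfderiv (𝓡 n) (𝓡 n) φ.symm p.1 (EuclideanSpace.single i (1 : ℝ))

/-- The coordinate range of the slit tangent bundle over the domain of the chart `φ`. -/
def slitDomain (φ : OpenPartialHomeomorph M (EuclideanSpace ℝ (Fin n))) : Set (ChartPt n) :=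
  {p | p.1 ∈ φ.target ∧ p.2 ≠ 0}

variable (n M) in
/-- A Finsler structure on `M`. -/
structure FinslerStructure where
  /-- The Finsler function. -/
  toFun : TangentBundle (𝓡 n) M → ℝ
  continuous_toFun : Continuous toFun
  smooth_toFun : ContMDiffOn (𝓡 n).tangent 𝓘(ℝ, ℝ) ∞ toFun {u | u.2 ≠ 0}
  map_zero : ∀ u, u.2 = 0 → toFun u = 0
  pos : ∀ u, u.2 ≠ 0 → 0 < toFun u
  homogeneous : ∀ (u : TangentBundle (𝓡 n) M) (c : ℝ), 0 < c →
    toFun ⟨u.1, c • u.2⟩ = c * toFun u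
  posDef : ∀ φ ∈ atlas (EuclideanSpace ℝ (Fin n)) M, ∀ p ∈ slitDomain φ,
    (ChartFinsler.metricMatrix (fun q => toFun (chartVec φ q)) p).PosDef

/-- The coordinate expression of the Finsler function in the chart `φ`. -/
def FinslerStructure.inChart (L : FinslerStructure n M)
    (φ : OpenPartialHomeomorph M (EuclideanSpace ℝ (Fin n))) (p : ChartPt n) : ℝ :=
  L.toFun (chartVec φ p)

variable (n M) in
/-- A smooth scalar π-one-form on the slit tangent bundle, positively homogeneous of degree zero
in `y`. (Its values on the zero section are irrelevant.) -/
structure PiOneForm where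
  /-- The value at `u`, a linear form on the fibre of the pullback bundle over `u`. -/
  toFun : (u : TangentBundle (𝓡 n) M) → (TangentSpace (𝓡 n) u.1 →ₗ[ℝ] ℝ)
  smooth_toFun : ∀ φ ∈ atlas (EuclideanSpace ℝ (Fin n)) M, ∀ i,
    ContDiffOn ℝ ∞ (fun p => toFun (chartVec φ p) (chartBasisVec φ p i)) (slitDomain φ)
  homogeneous : ∀ u : TangentBundle (𝓡 n) M, u.2 ≠ 0 → ∀ c : ℝ, 0 < c →
    toFun ⟨u.1, c • u.2⟩ = toFun u

/-- The components of a π-one-form in the chart `φ`. -/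
def PiOneForm.comp (A : PiOneForm n M)
    (φ : OpenPartialHomeomorph M (EuclideanSpace ℝ (Fin n))) (i : Fin n) (p : ChartPt n) : ℝ :=
  A.toFun (chartVec φ p) (chartBasisVec φ p i)

/-- The form does not vanish identically on the slit tangent bundle. -/
def PiOneForm.Nonzero (A : PiOneForm n M) : Prop := ∃ u, u.2 ≠ 0 ∧ A.toFun u ≠ 0

variable (n M) in
/-- A smooth scalar π-two-form (a covariant π-tensor of order two, not necessarily alternating)
on the slit tangent bundle, positively homogeneous of degree zero in `y`. -/
structure PiTwoForm where
  /-- The value at `u`, a bilinear form on the fibre of the pullback bundle over `u`. -/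
  toFun : (u : TangentBundle (𝓡 n) M) →
    (TangentSpace (𝓡 n) u.1 →ₗ[ℝ] TangentSpace (𝓡 n) u.1 →ₗ[ℝ] ℝ)
  smooth_toFun : ∀ φ ∈ atlas (EuclideanSpace ℝ (Fin n)) M, ∀ i j,
    ContDiffOn ℝ ∞
      (fun p => toFun (chartVec φ p) (chartBasisVec φ p i) (chartBasisVec φ p j)) (slitDomain φ)
  homogeneous : ∀ u : TangentBundle (𝓡 n) M, u.2 ≠ 0 → ∀ c : ℝ, 0 < c →
    toFun ⟨u.1, c • u.2⟩ = toFun u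

/-- The components of a π-two-form in the chart `φ`. -/
def PiTwoForm.comp (α : PiTwoForm n M)
    (φ : OpenPartialHomeomorph M (EuclideanSpace ℝ (Fin n))) (i j : Fin n) (p : ChartPt n) : ℝ :=
  α.toFun (chartVec φ p) (chartBasisVec φ p i) (chartBasisVec φ p j)

/-- The form does not vanish identically on the slit tangent bundle. -/
def PiTwoForm.Nonzero (α : PiTwoForm n M) : Prop := ∃ u, u.2 ≠ 0 ∧ α.toFun u ≠ 0

namespace FinslerStructure

open ChartFinsler

variable (L : FinslerStructure n M)

/-- `R ≠ 0`: the h-curvature tensor does not vanish identically. -/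
def CurvNonzero : Prop :=
  ∃ φ ∈ atlas (EuclideanSpace ℝ (Fin n)) M, ∃ p ∈ slitDomain φ, ∃ i j k l,
    hCurv (L.inChart φ) i j k l p ≠ 0

/-- `Ric ≠ 0`: the horizontal Ricci tensor does not vanish identically. -/
def RicciNonzero : Prop :=
  ∃ φ ∈ atlas (EuclideanSpace ℝ (Fin n)) M, ∃ p ∈ slitDomain φ, ∃ i j,
    ricci (L.inChart φ) i j p ≠ 0

/-- `C ≠ 0`: the concircular curvature tensor does not vanish identically. -/
def ConcircularNonzero : Prop :=
  ∃ φ ∈ atlas (EuclideanSpace ℝ (Fin n)) M, ∃ p ∈ slitDomain φ, ∃ i j k l,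
    concircular (L.inChart φ) i j k l p ≠ 0

/-- `r ≠ 0`: the horizontal scalar curvature does not vanish identically. -/
def ScalarCurvNonzero : Prop :=
  ∃ φ ∈ atlas (EuclideanSpace ℝ (Fin n)) M, ∃ p ∈ slitDomain φ, scalarCurv (L.inChart φ) p ≠ 0

/-- `R̂ = 0`: the horizontal distribution is completely integrable. -/
def CurvHatZero : Prop :=
  ∀ φ ∈ atlas (EuclideanSpace ℝ (Fin n)) M, ∀ p ∈ slitDomain φ, ∀ i k l,
    hCurvHat (L.inChart φ) i k l p = 0

/-- `∇B + A ⊗ B ≠ 0`, where `∇B` has the components `B_{i|j}` and `A ⊗ B` has the components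
`A_i B_j`. -/
def DerivAddTensorNonzero (A B : PiOneForm n M) : Prop :=
  ∃ φ ∈ atlas (EuclideanSpace ℝ (Fin n)) M, ∃ p ∈ slitDomain φ, ∃ i j,
    hCov1 (L.inChart φ) (B.comp φ) i j p + A.comp φ i p * B.comp φ j p ≠ 0

/-- Recurrent: `∇R = A ⊗ R`. -/
def IsRecurrent : Prop :=
  L.CurvNonzero ∧ ∃ A : PiOneForm n M, A.Nonzero ∧
    ∀ φ ∈ atlas (EuclideanSpace ℝ (Fin n)) M, ∀ p ∈ slitDomain φ, ∀ m i j k l,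
      hCov13 (L.inChart φ) (hCurv (L.inChart φ)) m i j k l p =
        A.comp φ m p * hCurv (L.inChart φ) i j k l p

/-- Generalized recurrent with recurrence forms `A` and `B`: `∇R = A ⊗ R + B ⊗ G`. -/
def IsGeneralizedRecurrentWith (A B : PiOneForm n M) : Prop :=
  L.CurvNonzero ∧ A.Nonzero ∧ B.Nonzero ∧
    ∀ φ ∈ atlas (EuclideanSpace ℝ (Fin n)) M, ∀ p ∈ slitDomain φ, ∀ m i j k l,
      hCov13 (L.inChart φ) (hCurv (L.inChart φ)) m i j k l p =
        A.comp φ m p * hCurv (L.inChart φ) i j k l p +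
          B.comp φ m p * tensorG (L.inChart φ) i j k l p

/-- Generalized 2-recurrent: `∇∇R = α ⊗ R + μ ⊗ G`. -/
def IsGeneralizedTwoRecurrent : Prop :=
  L.CurvNonzero ∧ ∃ α μ : PiTwoForm n M, α.Nonzero ∧ μ.Nonzero ∧
    ∀ φ ∈ atlas (EuclideanSpace ℝ (Fin n)) M, ∀ p ∈ slitDomain φ, ∀ m q i j k l,
      hCov13Second (L.inChart φ) (hCurv (L.inChart φ)) m q i j k l p =
        α.comp φ m q p * hCurv (L.inChart φ) i j k l p +
          μ.comp φ m q p * tensorG (L.inChart φ) i j k l p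

/-- Concircularly recurrent: `∇C = A ⊗ C`. -/
def IsConcircularlyRecurrent : Prop :=
  L.ConcircularNonzero ∧ ∃ A : PiOneForm n M, A.Nonzero ∧
    ∀ φ ∈ atlas (EuclideanSpace ℝ (Fin n)) M, ∀ p ∈ slitDomain φ, ∀ m i j k l,
      hCov13 (L.inChart φ) (concircular (L.inChart φ)) m i j k l p =
        A.comp φ m p * concircular (L.inChart φ) i j k l p

/-- 2-concircularly recurrent: `∇∇C = α ⊗ C`. -/
def IsTwoConcircularlyRecurrent : Prop :=
  L.ConcircularNonzero ∧ ∃ α : PiTwoForm n M, α.Nonzero ∧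
    ∀ φ ∈ atlas (EuclideanSpace ℝ (Fin n)) M, ∀ p ∈ slitDomain φ, ∀ m q i j k l,
      hCov13Second (L.inChart φ) (concircular (L.inChart φ)) m q i j k l p =
        α.comp φ m q p * concircular (L.inChart φ) i j k l p

/-- Generalized Ricci recurrent: `∇Ric = A ⊗ Ric + B ⊗ g`. -/
def IsGeneralizedRicciRecurrent : Prop :=
  L.RicciNonzero ∧ ∃ A B : PiOneForm n M, A.Nonzero ∧ B.Nonzero ∧
    ∀ φ ∈ atlas (EuclideanSpace ℝ (Fin n)) M, ∀ p ∈ slitDomain φ, ∀ m i j,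
      hCov2 (L.inChart φ) (ricci (L.inChart φ)) i j m p =
        A.comp φ m p * ricci (L.inChart φ) i j p +
          B.comp φ m p * metric (L.inChart φ) i j p

end FinslerStructure

end Manifold

end

/-! The Cartan connection is horizontally metrical (`IsFinslerOn.hpd_metric`), so `g`, its inverse
and the tensor `G`, built from `g` and Kronecker deltas, are parallel. Differentiating ∇R = A⊗R +
B⊗G once more and substituting the equation into itself gives ∇∇R = (∇A + A⊗A)⊗R + (∇B + A⊗B)⊗G
(`hCov13Second_of_recurrent`). Traces commute with ∇, the Ricci trace of `G` is (n-1)g and that of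
`g` is n; hence ∇Ric = A⊗Ric + (n-1)B⊗g and ∇r = rA + n(n-1)B. Therefore the B-terms in ∇C cancel
and ∇C = A⊗C (`hCov13_concircular_of_recurrent`); differentiating again is the earlier computation
with B replaced by 0. Ric cannot vanish identically, since its equation would then read (n-1)B⊗g =
0.

For (e), the vanishing deflection of the Cartan connection (`sum_hCoeff_mul_coord`) makes η
horizontally parallel, so R(X,Y)η = 0 implies (∇R)η = 0, and what remains is B⊗G(·,·)η = 0. As
G(·,·)η does not vanish off the zero section, B = 0 and the recurrence equation loses its last term.
This contradicts `B.Nonzero`, so (e) is vacuously true as well; the argument does not exploit that.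

The longest part shows that ∇A + A⊗A and ∇B + A⊗B, defined by formulas in charts, are global
two-forms of degree zero in y. Both facts come from one naturality statement, for the maps (x, y) ↦
(f(x), c·Df(x)y): a coordinate change f with c = 1 gives the tensor law, and f = id with c > 0 gives
homogeneity. The latter also yields the homogeneity of the spray, on which the vanishing deflection
rests. -/

noncomputable section

namespace ChartFinsler

variable {n : ℕ} {L : ChartPt n → ℝ} {f g : ChartPt n → ℝ} {p : ChartPt n}

/-! ### Directional derivatives -/

/-- The horizontal vector `δ_j` as a tangent vector of the chart. -/
def hvec (L : ChartPt n → ℝ) (j : Fin n) (p : ChartPt n) : ChartPt n :=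
  (EuclideanSpace.single j 1, -∑ m, nonlin L m j p • EuclideanSpace.single m (1 : ℝ))

/-- At a fixed point `δ_j` is a single tangent vector, so all its derivation rules are inherited
from `fderiv`. -/
lemma hpd_eq_fderiv (j : Fin n) (f : ChartPt n → ℝ) (p : ChartPt n) :
    hpd L j f p = fderiv ℝ f p (hvec L j p) := by
  have h : hvec L j p = (EuclideanSpace.single j 1, 0)
      - ∑ m, nonlin L m j p • ((0, EuclideanSpace.single m (1 : ℝ)) : ChartPt n) := by
    ext i
    · simp [hvec, Prod.fst_sum]
    · simp [hvec, Prod.snd_sum]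
  rw [h, map_sub, map_sum]
  simp only [hpd, pdx, pdy, map_smul, smul_eq_mul]

lemma hpd_mul (j : Fin n) (hf : DifferentiableAt ℝ f p) (hg : DifferentiableAt ℝ g p) :
    hpd L j (fun q => f q * g q) p = hpd L j f p * g p + f p * hpd L j g p := by
  simp only [hpd_eq_fderiv, fderiv_fun_mul hf hg]
  simp
  ring

lemma hpd_add (j : Fin n) (hf : DifferentiableAt ℝ f p) (hg : DifferentiableAt ℝ g p) :
    hpd L j (fun q => f q + g q) p = hpd L j f p + hpd L j g p := by
  simp [hpd_eq_fderiv, fderiv_fun_add hf hg]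

lemma hpd_sub (j : Fin n) (hf : DifferentiableAt ℝ f p) (hg : DifferentiableAt ℝ g p) :
    hpd L j (fun q => f q - g q) p = hpd L j f p - hpd L j g p := by
  simp [hpd_eq_fderiv, fderiv_fun_sub hf hg]

lemma hpd_const_mul (j : Fin n) (c : ℝ) (hf : DifferentiableAt ℝ f p) :
    hpd L j (fun q => c * f q) p = c * hpd L j f p := by
  simp [hpd_eq_fderiv, fderiv_const_mul hf]

lemma hpd_const (j : Fin n) (c : ℝ) : hpd L j (fun _ => c) p = 0 := by
  simp [hpd_eq_fderiv]

lemma hpd_sum {ι : Type*} {s : Finset ι} {F : ι → ChartPt n → ℝ} (j : Fin n)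
    (hF : ∀ i ∈ s, DifferentiableAt ℝ (F i) p) :
    hpd L j (fun q => ∑ i ∈ s, F i q) p = ∑ i ∈ s, hpd L j (F i) p := by
  simp [hpd_eq_fderiv, fderiv_fun_sum hF]

lemma hpd_congr (j : Fin n) (h : f =ᶠ[nhds p] g) : hpd L j f p = hpd L j g p := by
  simp [hpd_eq_fderiv, h.fderiv_eq]

lemma pdx_congr (j : Fin n) (h : f =ᶠ[nhds p] g) : pdx j f p = pdx j g p := by
  simp [pdx, h.fderiv_eq]

lemma pdy_congr (j : Fin n) (h : f =ᶠ[nhds p] g) : pdy j f p = pdy j g p := by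
  simp [pdy, h.fderiv_eq]

lemma pdy_mul (j : Fin n) (hf : DifferentiableAt ℝ f p) (hg : DifferentiableAt ℝ g p) :
    pdy j (fun q => f q * g q) p = pdy j f p * g p + f p * pdy j g p := by
  simp only [pdy, fderiv_fun_mul hf hg]
  simp
  ring

lemma pdx_mul (j : Fin n) (hf : DifferentiableAt ℝ f p) (hg : DifferentiableAt ℝ g p) :
    pdx j (fun q => f q * g q) p = pdx j f p * g p + f p * pdx j g p := by
  simp only [pdx, fderiv_fun_mul hf hg]
  simp
  ring

lemma pdy_sub (j : Fin n) (hf : DifferentiableAt ℝ f p) (hg : DifferentiableAt ℝ g p) :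
    pdy j (fun q => f q - g q) p = pdy j f p - pdy j g p := by
  simp [pdy, fderiv_fun_sub hf hg]

lemma pdy_const_mul (j : Fin n) (c : ℝ) (hf : DifferentiableAt ℝ f p) :
    pdy j (fun q => c * f q) p = c * pdy j f p := by
  simp [pdy, fderiv_const_mul hf]

lemma pdx_const_mul (j : Fin n) (c : ℝ) (hf : DifferentiableAt ℝ f p) :
    pdx j (fun q => c * f q) p = c * pdx j f p := by
  simp [pdx, fderiv_const_mul hf]

lemma pdy_sum {ι : Type*} {s : Finset ι} {F : ι → ChartPt n → ℝ} (j : Fin n)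
    (hF : ∀ i ∈ s, DifferentiableAt ℝ (F i) p) :
    pdy j (fun q => ∑ i ∈ s, F i q) p = ∑ i ∈ s, pdy j (F i) p := by
  simp [pdy, fderiv_fun_sum hF]

lemma pdx_sum {ι : Type*} {s : Finset ι} {F : ι → ChartPt n → ℝ} (j : Fin n)
    (hF : ∀ i ∈ s, DifferentiableAt ℝ (F i) p) :
    pdx j (fun q => ∑ i ∈ s, F i q) p = ∑ i ∈ s, pdx j (F i) p := by
  simp [pdx, fderiv_fun_sum hF]

lemma hasFDerivAt_coord (k : Fin n) (p : ChartPt n) :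
    HasFDerivAt (fun q : ChartPt n => q.2 k)
      ((EuclideanSpace.proj k).comp (ContinuousLinearMap.snd ℝ _ _)) p :=
  ((EuclideanSpace.proj (𝕜 := ℝ) k).comp
    (ContinuousLinearMap.snd ℝ (EuclideanSpace ℝ (Fin n)) _)).hasFDerivAt

lemma contDiff_coord (k : Fin n) : ContDiff ℝ ∞ (fun q : ChartPt n => q.2 k) :=
  ((EuclideanSpace.proj (𝕜 := ℝ) k).comp
    (ContinuousLinearMap.snd ℝ (EuclideanSpace ℝ (Fin n)) _)).contDiff

lemma pdy_coord (j k : Fin n) (p : ChartPt n) :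
    pdy j (fun q : ChartPt n => q.2 k) p = if k = j then 1 else 0 := by
  simp [pdy, (hasFDerivAt_coord k p).fderiv]

lemma pdx_coord (j k : Fin n) (p : ChartPt n) :
    pdx j (fun q : ChartPt n => q.2 k) p = 0 := by
  simp [pdx, (hasFDerivAt_coord k p).fderiv]

lemma hpd_coord (j k : Fin n) (p : ChartPt n) :
    hpd L j (fun q : ChartPt n => q.2 k) p = -nonlin L k j p := by
  simp [hpd, pdx_coord, pdy_coord]

/-! ### Smoothness -/

lemma contDiffAt_fderiv_apply (v : ChartPt n) (hf : ContDiffAt ℝ ∞ f p) :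
    ContDiffAt ℝ ∞ (fun q => fderiv ℝ f q v) p :=
  (hf.fderiv_right (m := ∞) (by simp)).clm_apply contDiffAt_const

lemma contDiffAt_pdx (i : Fin n) (hf : ContDiffAt ℝ ∞ f p) : ContDiffAt ℝ ∞ (pdx i f) p :=
  contDiffAt_fderiv_apply _ hf

lemma contDiffAt_pdy (i : Fin n) (hf : ContDiffAt ℝ ∞ f p) : ContDiffAt ℝ ∞ (pdy i f) p :=
  contDiffAt_fderiv_apply _ hf

/-- Symmetry of the second derivative; it covers both the mixed `x`-`y` and the pure `y` partials.
-/
lemma fderiv_fderiv_comm (v w : ChartPt n) (hf : ContDiffAt ℝ ∞ f p) :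
    fderiv ℝ (fun q => fderiv ℝ f q v) p w = fderiv ℝ (fun q => fderiv ℝ f q w) p v := by
  have h := (hf.fderiv_right (m := ∞) (by simp)).differentiableAt (by simp)
  have key : ∀ u, fderiv ℝ (fun q => fderiv ℝ f q u) p = (fderiv ℝ (fderiv ℝ f) p).flip u := by
    intro u
    refine ContinuousLinearMap.ext fun x => ?_
    rw [fderiv_clm_apply h (differentiableAt_const u)]
    simp
  have hs : IsSymmSndFDerivAt ℝ f p := hf.isSymmSndFDerivAt 
    (by simpa using WithTop.coe_le_coe.2 (le_top : (2 : ℕ∞) ≤ ⊤))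
  rw [key, key]
  exact hs.eq w v

lemma pdy_pdy_comm (i j : Fin n) (hf : ContDiffAt ℝ ∞ f p) :
    pdy i (pdy j f) p = pdy j (pdy i f) p := fderiv_fderiv_comm _ _ hf

lemma pdx_pdy_comm (i j : Fin n) (hf : ContDiffAt ℝ ∞ f p) :
    pdx i (pdy j f) p = pdy j (pdx i f) p := fderiv_fderiv_comm _ _ hf

/-- `L` is smooth with positive definite fundamental tensor on the open set `U`. -/
structure IsFinslerOn (L : ChartPt n → ℝ) (U : Set (ChartPt n)) : Prop where
  isOpen : IsOpen U
  smooth : ContDiffOn ℝ ∞ L U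
  posDef : ∀ p ∈ U, (metricMatrix L p).PosDef

namespace IsFinslerOn

variable {U : Set (ChartPt n)} (h : IsFinslerOn L U) (hp : p ∈ U)
include h hp

lemma mem_nhds : U ∈ nhds p := h.isOpen.mem_nhds hp

lemma contDiffAt : ContDiffAt ℝ ∞ L p := h.smooth.contDiffAt (h.mem_nhds hp)

lemma contDiffAt_sq : ContDiffAt ℝ ∞ (fun q => L q ^ 2) p := (h.contDiffAt hp).pow 2

lemma det_ne_zero : (metricMatrix L p).det ≠ 0 := (h.posDef p hp).det_pos.ne'

lemma contDiffAt_metric (i j : Fin n) : ContDiffAt ℝ ∞ (metric L i j) p :=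
  contDiffAt_const.mul (contDiffAt_pdy _ (contDiffAt_pdy _ (h.contDiffAt_sq hp)))

lemma metric_symm (i j : Fin n) : metric L i j p = metric L j i p := by
  simp only [metric]
  rw [pdy_pdy_comm _ _ (h.contDiffAt_sq hp)]

/-- Cramer's rule: the inverse is the adjugate, polynomial in the entries, divided by a determinant
that does not vanish. -/
lemma contDiffAt_invMetric (i j : Fin n) : ContDiffAt ℝ ∞ (invMetric L i j) p := by
  have hM : ContDiffAt ℝ ∞ (fun q => (metricMatrix L q).det) p := by
    simp only [Matrix.det_apply', metricMatrix, Matrix.of_apply]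
    exact ContDiffAt.sum fun σ _ => contDiffAt_const.mul
      (contDiffAt_prod fun k _ => h.contDiffAt_metric hp _ _)
  have hA : ContDiffAt ℝ ∞ (fun q => (metricMatrix L q).adjugate i j) p := by
    simp only [Matrix.adjugate_apply, Matrix.det_apply']
    refine ContDiffAt.sum fun σ _ => contDiffAt_const.mul (contDiffAt_prod fun k _ => ?_)
    simp only [Matrix.updateRow_apply]
    split_ifs
    · exact contDiffAt_const
    · exact h.contDiffAt_metric hp _ _
  have : invMetric L i j
      = fun q => ((metricMatrix L q).det)⁻¹ * (metricMatrix L q).adjugate i j := by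
    ext q
    simp [invMetric, Matrix.inv_def]
  rw [this]
  exact (hM.inv (h.det_ne_zero hp)).mul hA

lemma contDiffAt_spray (i : Fin n) : ContDiffAt ℝ ∞ (spray L i) p := by
  have hs := h.contDiffAt_sq hp
  refine contDiffAt_const.mul (ContDiffAt.sum fun l _ => (h.contDiffAt_invMetric hp i l).mul ?_)
  exact (ContDiffAt.sum fun k _ => (contDiff_coord k).contDiffAt.mul
    (contDiffAt_pdx _ (contDiffAt_pdy _ hs))).sub (contDiffAt_pdx _ hs)

lemma contDiffAt_nonlin (i j : Fin n) : ContDiffAt ℝ ∞ (nonlin L i j) p :=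
  contDiffAt_pdy _ (h.contDiffAt_spray hp i)

lemma contDiffAt_hpd (j : Fin n) (hf : ContDiffAt ℝ ∞ f p) : ContDiffAt ℝ ∞ (hpd L j f) p :=
  (contDiffAt_pdx _ hf).sub
    (ContDiffAt.sum fun m _ => (h.contDiffAt_nonlin hp m j).mul (contDiffAt_pdy _ hf))

lemma contDiffAt_hCoeff (i j k : Fin n) : ContDiffAt ℝ ∞ (hCoeff L i j k) p :=
  contDiffAt_const.mul (ContDiffAt.sum fun l _ => (h.contDiffAt_invMetric hp i l).mul
    (((h.contDiffAt_hpd hp _ (h.contDiffAt_metric hp _ _)).add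
      (h.contDiffAt_hpd hp _ (h.contDiffAt_metric hp _ _))).sub
      (h.contDiffAt_hpd hp _ (h.contDiffAt_metric hp _ _))))

lemma contDiffAt_vCoeff (i j k : Fin n) : ContDiffAt ℝ ∞ (vCoeff L i j k) p :=
  contDiffAt_const.mul (ContDiffAt.sum fun l _ => (h.contDiffAt_invMetric hp i l).mul
    (contDiffAt_pdy _ (h.contDiffAt_metric hp _ _)))

lemma contDiffAt_hCurv (i j k l : Fin n) : ContDiffAt ℝ ∞ (hCurv L i j k l) p := by
  have hC := h.contDiffAt_hCoeff hp
  refine ((((h.contDiffAt_hpd hp _ (hC _ _ _)).sub (h.contDiffAt_hpd hp _ (hC _ _ _))).add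
    (ContDiffAt.sum fun m _ => (hC _ _ _).mul (hC _ _ _))).sub
    (ContDiffAt.sum fun m _ => (hC _ _ _).mul (hC _ _ _))).add
    (ContDiffAt.sum fun m _ => (h.contDiffAt_vCoeff hp _ _ _).mul
      ((h.contDiffAt_hpd hp _ (h.contDiffAt_nonlin hp _ _)).sub
        (h.contDiffAt_hpd hp _ (h.contDiffAt_nonlin hp _ _))))

lemma contDiffAt_ricci (j k : Fin n) : ContDiffAt ℝ ∞ (ricci L j k) p :=
  ContDiffAt.sum fun _ _ => h.contDiffAt_hCurv hp _ _ _ _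

lemma contDiffAt_scalarCurv : ContDiffAt ℝ ∞ (scalarCurv L) p :=
  ContDiffAt.sum fun _ _ => ContDiffAt.sum fun _ _ =>
    (h.contDiffAt_invMetric hp _ _).mul (h.contDiffAt_ricci hp _ _)

lemma contDiffAt_tensorG (i j k l : Fin n) : ContDiffAt ℝ ∞ (tensorG L i j k l) p :=
  ((h.contDiffAt_metric hp _ _).mul contDiffAt_const).sub
    ((h.contDiffAt_metric hp _ _).mul contDiffAt_const)

lemma contDiffAt_concircular (i j k l : Fin n) : ContDiffAt ℝ ∞ (concircular L i j k l) p :=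
  (h.contDiffAt_hCurv hp _ _ _ _).sub
    (((h.contDiffAt_scalarCurv hp).div_const _).mul (h.contDiffAt_tensorG hp _ _ _ _))

lemma contDiffAt_hCov1 {a : Fin n → ChartPt n → ℝ} (ha : ∀ i, ContDiffAt ℝ ∞ (a i) p)
    (i m : Fin n) : ContDiffAt ℝ ∞ (hCov1 L a i m) p :=
  (h.contDiffAt_hpd hp _ (ha i)).sub
    (ContDiffAt.sum fun s _ => (h.contDiffAt_hCoeff hp _ _ _).mul (ha s))

/-! ### The inverse metric -/

lemma sum_metric_mul_invMetric (i j : Fin n) :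
    ∑ l, metric L i l p * invMetric L l j p = if i = j then 1 else 0 := by
  have := congrFun (congrFun (Matrix.mul_nonsing_inv (metricMatrix L p)
    (h.det_ne_zero hp).isUnit) i) j
  simpa [Matrix.mul_apply, Matrix.one_apply, invMetric, metricMatrix] using this

lemma sum_invMetric_mul_metric (i j : Fin n) :
    ∑ l, invMetric L i l p * metric L l j p = if i = j then 1 else 0 := by
  have := congrFun (congrFun (Matrix.nonsing_inv_mul (metricMatrix L p)
    (h.det_ne_zero hp).isUnit) i) j
  simpa [Matrix.mul_apply, Matrix.one_apply, invMetric, metricMatrix] using this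

/-- Lowering an index that has been raised. -/
lemma sum_metric_mul_sum_invMetric (T : Fin n → ℝ) (a : Fin n) :
    ∑ i, metric L a i p * ∑ l, invMetric L i l p * T l = T a := by
  simp only [Finset.mul_sum, ← mul_assoc]
  rw [Finset.sum_comm]
  simp [← Finset.sum_mul, h.sum_metric_mul_invMetric hp]

/-- Nondegeneracy of `g`. Identities with an upper index are proved by lowering it, which removes
the inverse metric from `spray` and `hCoeff`. -/
lemma eq_of_sum_metric_mul_eq {X Y : Fin n → ℝ}
    (hXY : ∀ a, ∑ i, metric L a i p * X i = ∑ i, metric L a i p * Y i) (i : Fin n) :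
    X i = Y i := by
  have key : ∀ Z : Fin n → ℝ,
      ∑ a, invMetric L i a p * ∑ b, metric L a b p * Z b = Z i := by
    intro Z
    simp only [Finset.mul_sum, ← mul_assoc]
    rw [Finset.sum_comm]
    simp [← Finset.sum_mul, h.sum_invMetric_mul_metric hp]
  rw [← key X, ← key Y]
  simp [hXY]

/-- The Christoffel symbols of the first kind. -/
lemma sum_metric_mul_hCoeff (a j k : Fin n) :
    ∑ i, metric L a i p * hCoeff L i j k p =
      (1 / 2) * (hpd L j (metric L a k) p + hpd L k (metric L a j) p - hpd L a (metric L j k) p) := by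
  simp only [hCoeff, mul_left_comm _ (1 / 2 : ℝ), ← Finset.mul_sum]
  rw [h.sum_metric_mul_sum_invMetric hp
    (fun l => hpd L j (metric L l k) p + hpd L k (metric L l j) p - hpd L l (metric L j k) p)]

lemma sum_metric_mul_spray (a : Fin n) :
    ∑ i, metric L a i p * spray L i p =
      (1 / 4) * ((∑ k, p.2 k * pdx k (pdy a (fun q => L q ^ 2)) p)
        - pdx a (fun q => L q ^ 2) p) := by
  simp only [spray, mul_left_comm _ (1 / 4 : ℝ), ← Finset.mul_sum]
  rw [h.sum_metric_mul_sum_invMetric hp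
    (fun l => (∑ k, p.2 k * pdx k (pdy l (fun q => L q ^ 2)) p) - pdx l (fun q => L q ^ 2) p)]

lemma hpd_metric_symm (m i j : Fin n) : hpd L m (metric L i j) p = hpd L m (metric L j i) p :=
  hpd_congr _ (Filter.eventuallyEq_of_mem (h.mem_nhds hp) fun _ hq => h.metric_symm hq i j)

/-- The Cartan connection is horizontally metrical. -/
lemma hpd_metric (m i j : Fin n) :
    hpd L m (metric L i j) p =
      (∑ s, hCoeff L s m i p * metric L s j p) + ∑ s, hCoeff L s m j p * metric L i s p := by
  have h1 : ∑ s, hCoeff L s m i p * metric L s j p = ∑ s, metric L j s p * hCoeff L s m i p :=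
    Finset.sum_congr rfl fun s _ => by rw [h.metric_symm hp s j]; ring
  have h2 : ∑ s, hCoeff L s m j p * metric L i s p = ∑ s, metric L i s p * hCoeff L s m j p :=
    Finset.sum_congr rfl fun s _ => by ring
  rw [h1, h2, h.sum_metric_mul_hCoeff hp, h.sum_metric_mul_hCoeff hp,
    h.hpd_metric_symm hp m j i, h.hpd_metric_symm hp i j m, h.hpd_metric_symm hp j i m]
  ring

end IsFinslerOn

end ChartFinsler

namespace ChartFinsler

variable {n : ℕ} {L : ChartPt n → ℝ} {p : ChartPt n}

/-! ### Horizontal covariant derivatives of tensors -/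

lemma hCov13_congr {S T : Tensor13 n} (hST : ∀ i j k l, S i j k l =ᶠ[nhds p] T i j k l)
    (m i j k l : Fin n) : hCov13 L S m i j k l p = hCov13 L T m i j k l p := by
  simp only [hCov13, hpd_congr m (hST i j k l), (hST _ _ _ _).eq_of_nhds]

lemma hCov13_add {S T : Tensor13 n} (hS : ∀ i j k l, DifferentiableAt ℝ (S i j k l) p)
    (hT : ∀ i j k l, DifferentiableAt ℝ (T i j k l) p) (m i j k l : Fin n) :
    hCov13 L (fun i j k l q => S i j k l q + T i j k l q) m i j k l p =
      hCov13 L S m i j k l p + hCov13 L T m i j k l p := by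
  simp only [hCov13, hpd_add m (hS i j k l) (hT i j k l), mul_add, Finset.sum_add_distrib]
  ring

lemma hCov13_mul {f : ChartPt n → ℝ} {T : Tensor13 n} (hf : DifferentiableAt ℝ f p)
    (hT : ∀ i j k l, DifferentiableAt ℝ (T i j k l) p) (m i j k l : Fin n) :
    hCov13 L (fun i j k l q => f q * T i j k l q) m i j k l p =
      hpd L m f p * T i j k l p + f p * hCov13 L T m i j k l p := by
  simp only [hCov13, hpd_mul m hf (hT i j k l), mul_left_comm _ (f p), ← Finset.mul_sum]
  ring

/-- The contraction of the upper with the last lower index commutes with `∇`. -/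
lemma hCov2_contract {T : Tensor13 n} (hT : ∀ i j k l, DifferentiableAt ℝ (T i j k l) p)
    (i j m : Fin n) :
    hCov2 L (fun j k q => ∑ a, T a k j a q) i j m p = ∑ a, hCov13 L T m a j i a p := by
  simp only [hCov2, hCov13, Finset.sum_add_distrib, Finset.sum_sub_distrib,
    hpd_sum m fun a _ => hT a j i a, Finset.mul_sum]
  -- After this exchange the two connection terms for the contracted pair of indices coincide and,
  -- having opposite signs, cancel.
  rw [Finset.sum_comm (f := fun a s => hCoeff L a m s p * T s j i a p),
    Finset.sum_comm (f := fun s a => hCoeff L s m i p * T a j s a p),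
    Finset.sum_comm (f := fun s a => hCoeff L s m j p * T a s i a p)]
  ring

namespace IsFinslerOn

variable {U : Set (ChartPt n)} (h : IsFinslerOn L U) (hp : p ∈ U)
include h hp

lemma differentiableAt_metric (i j : Fin n) : DifferentiableAt ℝ (metric L i j) p :=
  (h.contDiffAt_metric hp i j).differentiableAt (by simp)

lemma differentiableAt_invMetric (i j : Fin n) : DifferentiableAt ℝ (invMetric L i j) p :=
  (h.contDiffAt_invMetric hp i j).differentiableAt (by simp)

lemma differentiableAt_hCurv (i j k l : Fin n) : DifferentiableAt ℝ (hCurv L i j k l) p :=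
  (h.contDiffAt_hCurv hp i j k l).differentiableAt (by simp)

lemma differentiableAt_tensorG (i j k l : Fin n) : DifferentiableAt ℝ (tensorG L i j k l) p :=
  (h.contDiffAt_tensorG hp i j k l).differentiableAt (by simp)

lemma differentiableAt_concircular (i j k l : Fin n) :
    DifferentiableAt ℝ (concircular L i j k l) p :=
  (h.contDiffAt_concircular hp i j k l).differentiableAt (by simp)

lemma differentiableAt_ricci (i j : Fin n) : DifferentiableAt ℝ (ricci L i j) p :=
  (h.contDiffAt_ricci hp i j).differentiableAt (by simp)

lemma differentiableAt_scalarCurv : DifferentiableAt ℝ (scalarCurv L) p :=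
  (h.contDiffAt_scalarCurv hp).differentiableAt (by simp)

/-- `G` is assembled from `g` and the identity, both of which are parallel. -/
lemma hCov13_tensorG (m i j k l : Fin n) : hCov13 L (tensorG L) m i j k l p = 0 := by
  have h1 : hpd L m (tensorG L i j k l) p =
      hpd L m (metric L k j) p * (if i = l then 1 else 0)
        - hpd L m (metric L l j) p * (if i = k then 1 else 0) := by
    have hG : tensorG L i j k l = fun q => (if i = l then 1 else 0) * metric L k j q
        - (if i = k then 1 else 0) * metric L l j q := by
      ext q
      simp only [tensorG, mul_comm]
    rw [hG, hpd_sub, hpd_const_mul, hpd_const_mul, mul_comm, mul_comm (hpd L m (metric L l j) p)]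
    all_goals first
      | exact h.differentiableAt_metric hp _ _
      | exact (h.differentiableAt_metric hp _ _).const_mul _
  simp only [hCov13, h1, h.hpd_metric hp]
  simp only [tensorG, mul_sub, Finset.sum_sub_distrib, mul_ite, mul_one, mul_zero, Finset.sum_ite_eq, Finset.sum_ite_eq', Finset.mem_univ, if_true]
  split_ifs <;> (try simp only [Finset.sum_const_zero]) <;> ring

/-- The inverse metric is parallel: apply `δ_m` to the constant `g · g⁻¹` and use that `g` is
parallel. -/
lemma hpd_invMetric (m i j : Fin n) :
    hpd L m (invMetric L i j) p =
      -(∑ s, hCoeff L i m s p * invMetric L s j p) - ∑ s, hCoeff L j m s p * invMetric L i s p := by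
  refine h.eq_of_sum_metric_mul_eq hp (X := fun i => hpd L m (invMetric L i j) p)
    (Y := fun i => -(∑ s, hCoeff L i m s p * invMetric L s j p)
      - ∑ s, hCoeff L j m s p * invMetric L i s p) (fun a => ?_) i
  have h0 : hpd L m (fun q => ∑ l, metric L a l q * invMetric L l j q) p = 0 := by
    rw [hpd_congr m (g := fun _ => if a = j then 1 else 0)
      (Filter.eventuallyEq_of_mem (h.mem_nhds hp) fun q hq => h.sum_metric_mul_invMetric hq a j),
      hpd_const]
  rw [hpd_sum (F := fun l q => metric L a l q * invMetric L l j q) m fun l _ => (h.differentiableAt_metric hp a l).mul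
    (h.differentiableAt_invMetric hp l j)] at h0
  simp only [hpd_mul m (h.differentiableAt_metric hp a _) (h.differentiableAt_invMetric hp _ j),
    Finset.sum_add_distrib, h.hpd_metric hp, add_mul] at h0
  have h1 : ∑ l, (∑ s, hCoeff L s m a p * metric L s l p) * invMetric L l j p
      = hCoeff L j m a p := by
    simp only [Finset.sum_mul, mul_assoc]
    rw [Finset.sum_comm]
    simp [← Finset.mul_sum, h.sum_metric_mul_invMetric hp]
  have h2 : ∑ l, metric L a l p * ∑ s, hCoeff L l m s p * invMetric L s j p
      = ∑ l, (∑ s, hCoeff L s m l p * metric L a s p) * invMetric L l j p := by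
    simp only [Finset.sum_mul, Finset.mul_sum]
    rw [Finset.sum_comm]
    exact Finset.sum_congr rfl fun _ _ => Finset.sum_congr rfl fun _ _ => by ring
  have h3 : ∑ l, metric L a l p * ∑ s, hCoeff L j m s p * invMetric L l s p
      = hCoeff L j m a p := by
    simp only [Finset.mul_sum, mul_left_comm (metric L a _ p)]
    rw [Finset.sum_comm]
    simp [← Finset.mul_sum, h.sum_metric_mul_invMetric hp]
  simp only [mul_sub, mul_neg, Finset.sum_sub_distrib, Finset.sum_neg_distrib, h2, h3]
  linarith

lemma hCov2_ricci (i j m : Fin n) :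
    hCov2 L (ricci L) i j m p = ∑ a, hCov13 L (hCurv L) m a j i a p :=
  hCov2_contract (fun i j k l => h.differentiableAt_hCurv hp i j k l) i j m

/-- Because `g⁻¹` is parallel, its connection terms cancel those of `T`, and the trace commutes with
`∇`. -/
lemma hpd_trace {T : Fin n → Fin n → ChartPt n → ℝ}
    (hT : ∀ i j, DifferentiableAt ℝ (T i j) p) (m : Fin n) :
    hpd L m (fun q => ∑ j, ∑ k, invMetric L j k q * T j k q) p =
      ∑ j, ∑ k, invMetric L j k p * hCov2 L T j k m p := by
  have hd : ∀ j k, DifferentiableAt ℝ (fun q => invMetric L j k q * T j k q) p :=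
    fun j k => (h.differentiableAt_invMetric hp j k).mul (hT j k)
  rw [hpd_sum m fun j _ => DifferentiableAt.fun_sum fun k _ => hd j k]
  simp only [hpd_sum m fun k _ => hd _ k, hpd_mul m (h.differentiableAt_invMetric hp _ _) (hT _ _),
    h.hpd_invMetric hp, hCov2]
  have h1 : ∑ j, ∑ k, (∑ s, hCoeff L j m s p * invMetric L s k p) * T j k p
      = ∑ j, ∑ k, invMetric L j k p * ∑ s, hCoeff L s m j p * T s k p := by
    rw [Finset.sum_comm]
    conv_rhs => rw [Finset.sum_comm]
    refine Finset.sum_congr rfl fun k _ => ?_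
    simp only [Finset.sum_mul, Finset.mul_sum]
    rw [Finset.sum_comm]
    exact Finset.sum_congr rfl fun _ _ => Finset.sum_congr rfl fun _ _ => by ring
  have h2 : ∑ j, ∑ k, (∑ s, hCoeff L k m s p * invMetric L j s p) * T j k p
      = ∑ j, ∑ k, invMetric L j k p * ∑ s, hCoeff L s m k p * T j s p := by
    refine Finset.sum_congr rfl fun k _ => ?_
    simp only [Finset.sum_mul, Finset.mul_sum]
    rw [Finset.sum_comm]
    exact Finset.sum_congr rfl fun _ _ => Finset.sum_congr rfl fun _ _ => by ring
  simp only [mul_sub, sub_mul, neg_mul, Finset.sum_add_distrib, Finset.sum_sub_distrib,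
    Finset.sum_neg_distrib, h1, h2]
  ring

lemma hpd_scalarCurv (m : Fin n) :
    hpd L m (scalarCurv L) p = ∑ j, ∑ k, invMetric L j k p * hCov2 L (ricci L) j k m p :=
  h.hpd_trace hp (fun i j => h.differentiableAt_ricci hp i j) m

omit h hp in
-- The trace of the identity contributes `n`, the remaining delta subtracts one.
lemma sum_tensorG (i j : Fin n) (p : ChartPt n) :
    ∑ a, tensorG L a j i a p = ((n : ℝ) - 1) * metric L i j p := by
  simp only [tensorG, if_true, mul_one, Finset.sum_sub_distrib, mul_ite, mul_zero,
    Finset.sum_ite_eq', Finset.mem_univ, Finset.sum_const, Finset.card_univ, Fintype.card_fin,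
    nsmul_eq_mul]
  ring

lemma sum_sum_invMetric_mul_metric :
    ∑ j, ∑ k, invMetric L j k p * metric L j k p = n := by
  calc ∑ j, ∑ k, invMetric L j k p * metric L j k p
      = ∑ j, ∑ k, invMetric L j k p * metric L k j p :=
        Finset.sum_congr rfl fun j _ => Finset.sum_congr rfl fun k _ => by
          rw [h.metric_symm hp j k]
    _ = n := by simp [h.sum_invMetric_mul_metric hp]

end IsFinslerOn

end ChartFinsler

namespace ChartFinsler

variable {n : ℕ} {L : ChartPt n → ℝ} {p : ChartPt n}

/-! ### Generalized recurrent curvature in a chart -/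

namespace IsFinslerOn

variable {U : Set (ChartPt n)} (h : IsFinslerOn L U) (hp : p ∈ U)
include h hp

lemma hCov2_ricci_of_recurrent {a b : Fin n → ChartPt n → ℝ} {m : Fin n}
    (hR : ∀ i j k l, hCov13 L (hCurv L) m i j k l p =
      a m p * hCurv L i j k l p + b m p * tensorG L i j k l p) (i j : Fin n) :
    hCov2 L (ricci L) i j m p =
      a m p * ricci L i j p + (((n : ℝ) - 1) * b m p) * metric L i j p := by
  simp only [h.hCov2_ricci hp, hR, Finset.sum_add_distrib, ← Finset.mul_sum, sum_tensorG]
  simp only [ricci]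
  ring

/-- The second trace multiplies the `b`-term of the Ricci equation by `tr_g g = n`. -/
lemma hpd_scalarCurv_of_recurrent {a b : Fin n → ChartPt n → ℝ} {m : Fin n}
    (hR : ∀ i j k l, hCov13 L (hCurv L) m i j k l p =
      a m p * hCurv L i j k l p + b m p * tensorG L i j k l p) :
    hpd L m (scalarCurv L) p = a m p * scalarCurv L p + (n * ((n : ℝ) - 1)) * b m p := by
  have h1 : ∀ j k, invMetric L j k p * hCov2 L (ricci L) j k m p =
      a m p * (invMetric L j k p * ricci L j k p)
        + (((n : ℝ) - 1) * b m p) * (invMetric L j k p * metric L j k p) := fun j k => by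
    rw [h.hCov2_ricci_of_recurrent hp hR]
    ring
  simp only [h.hpd_scalarCurv hp, h1, Finset.sum_add_distrib, ← Finset.mul_sum,
    h.sum_sum_invMetric_mul_metric hp]
  simp only [scalarCurv]
  ring

/-- The factor `1/(n(n-1))` in `C` is exactly the one for which `∇r` carries a `b`-term that removes
`b ⊗ G` from `∇R`. -/
lemma hCov13_concircular_of_recurrent (hn : 3 ≤ n) {a b : Fin n → ChartPt n → ℝ} {m : Fin n}
    (hR : ∀ i j k l, hCov13 L (hCurv L) m i j k l p =
      a m p * hCurv L i j k l p + b m p * tensorG L i j k l p) (i j k l : Fin n) :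
    hCov13 L (concircular L) m i j k l p = a m p * concircular L i j k l p := by
  have hn' : (3 : ℝ) ≤ n := by exact_mod_cast hn
  set c : ℝ := -((n : ℝ) * ((n : ℝ) - 1))⁻¹ with hc
  have hcn : c * (n * ((n : ℝ) - 1)) = -1 := by
    rw [hc, neg_mul, inv_mul_cancel₀]
    exact mul_ne_zero (by linarith) (by linarith)
  have hC : concircular L =
      fun i j k l q => hCurv L i j k l q + (c * scalarCurv L q) * tensorG L i j k l q := by
    ext i j k l q
    simp only [concircular, hc]
    ring
  have hs := h.differentiableAt_scalarCurv hp
  have hG := h.differentiableAt_tensorG hp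
  rw [hC, hCov13_add (T := fun i j k l q => (c * scalarCurv L q) * tensorG L i j k l q)
    (h.differentiableAt_hCurv hp) (fun i j k l => (hs.const_mul c).mul (hG i j k l)), hCov13_mul (hs.const_mul c) hG, h.hCov13_tensorG hp, hR, hpd_const_mul _ _ hs,
    h.hpd_scalarCurv_of_recurrent hp hR]
  linear_combination b m p * tensorG L i j k l p * hcn

/-- The second covariant derivative of a tensor with `∇T = a ⊗ T + b ⊗ S`, where `∇S = 0`. -/
lemma hCov13Second_of_recurrent {T S : Tensor13 n} {a b : Fin n → ChartPt n → ℝ}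
    (hT : ∀ i j k l, DifferentiableAt ℝ (T i j k l) p)
    (hS : ∀ i j k l, DifferentiableAt ℝ (S i j k l) p)
    (ha : ∀ i, DifferentiableAt ℝ (a i) p) (hb : ∀ i, DifferentiableAt ℝ (b i) p)
    (hS0 : ∀ m i j k l, hCov13 L S m i j k l p = 0)
    (hR : ∀ q ∈ U, ∀ m i j k l, hCov13 L T m i j k l q = a m q * T i j k l q + b m q * S i j k l q)
    (m q i j k l : Fin n) :
    hCov13Second L T m q i j k l p =
      (hCov1 L a m q p + a m p * a q p) * T i j k l p
        + (hCov1 L b m q p + a m p * b q p) * S i j k l p := by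
  -- The recurrence equation is needed near `p`, not only at `p`, since it is differentiated here.
  have h1 := hCov13_congr (L := L) (p := p) (S := hCov13 L T m)
    (T := fun i j k l q => a m q * T i j k l q + b m q * S i j k l q)
    (fun i j k l => Filter.eventuallyEq_of_mem (h.mem_nhds hp) fun q hq => hR q hq m i j k l)
    q i j k l
  rw [hCov13Second, h1, hCov13_add (S := fun i j k l q => a m q * T i j k l q)
    (T := fun i j k l q => b m q * S i j k l q) (fun i j k l => (ha m).mul (hT i j k l))
    (fun i j k l => (hb m).mul (hS i j k l)), hCov13_mul (ha m) hT, hCov13_mul (hb m) hS, hS0]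
  -- The correction for the tensorial index `m` turns `δ_q a_m` and `δ_q b_m` into the covariant
  -- derivatives `hCov1`.
  simp only [hR p hp, hCov1, mul_add, Finset.sum_add_distrib, ← mul_assoc, ← Finset.sum_mul]
  ring

end IsFinslerOn

/-! ### Homogeneity and the deflection tensor -/

/-- Euler's relation for a function that is homogeneous of degree `d` along the ray through `p`. -/
lemma sum_coord_mul_pdy {f : ChartPt n → ℝ} (d : ℕ) (hf : DifferentiableAt ℝ f p)
    (hh : ∀ c : ℝ, 0 < c → f (p.1, c • p.2) = c ^ d * f p) :
    ∑ k, p.2 k * pdy k f p = d * f p := by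
  have hv : ((0, p.2) : ChartPt n)
      = ∑ k, p.2 k • ((0, EuclideanSpace.single k (1 : ℝ)) : ChartPt n) := by
    ext i
    · simp [Prod.fst_sum]
    · simp [Prod.snd_sum, Pi.single_apply]
  have h1 : ∑ k, p.2 k * pdy k f p = fderiv ℝ f p (0, p.2) := by
    rw [hv, map_sum]
    simp only [map_smul, smul_eq_mul, pdy]
  rw [h1]
  -- The derivative of `c ↦ f (x, c y)` at `c = 1` is computed twice, by the chain rule and from
  -- homogeneity.
  have hγ : HasDerivAt (fun c : ℝ => ((p.1, c • p.2) : ChartPt n)) (0, p.2) 1 := by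
    have h2 : HasDerivAt (fun c : ℝ => c • p.2) p.2 1 := by
      simpa using (hasDerivAt_id (1 : ℝ)).smul_const p.2
    exact (hasDerivAt_const (1 : ℝ) p.1).prodMk h2
  have hd1 : HasDerivAt (fun c : ℝ => f (p.1, c • p.2)) (fderiv ℝ f p (0, p.2)) 1 := by
    have hf' : HasFDerivAt f (fderiv ℝ f p) (p.1, (1 : ℝ) • p.2) := by
      simpa using hf.hasFDerivAt
    exact hf'.comp_hasDerivAt (1 : ℝ) hγ
  have hd2 : HasDerivAt (fun c : ℝ => f (p.1, c • p.2)) (d * f p) 1 := by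
    have h3 : HasDerivAt (fun c : ℝ => c ^ d * f p) (d * f p) 1 := by
      simpa using (hasDerivAt_pow d (1 : ℝ)).mul_const (f p)
    refine h3.congr_of_eventuallyEq ?_
    filter_upwards [lt_mem_nhds one_pos] with c hc using hh c hc
  exact hd1.unique hd2

end ChartFinsler

namespace ChartFinsler

variable {n : ℕ}

/-! ### Naturality of the Cartan connection -/

/-- The map `(x, y) ↦ (f(x), c · Df(x) y)`. -/
def tangentScale (f : EuclideanSpace ℝ (Fin n) → EuclideanSpace ℝ (Fin n)) (c : ℝ)
    (p : ChartPt n) : ChartPt n :=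
  (f p.1, c • fderiv ℝ f p.1 p.2)

/-- The Jacobian matrix of `f`, as a function of `(x, y)`. -/
def jac (f : EuclideanSpace ℝ (Fin n) → EuclideanSpace ℝ (Fin n)) (a i : Fin n)
    (p : ChartPt n) : ℝ :=
  fderiv ℝ f p.1 (EuclideanSpace.single i 1) a

/-- The matrix `y ↦ D²f(x)(e_k, y)`. -/
def hessMul (f : EuclideanSpace ℝ (Fin n) → EuclideanSpace ℝ (Fin n)) (a k : Fin n)
    (p : ChartPt n) : ℝ :=
  ∑ m, pdx k (jac f a m) p * p.2 m

variable {f : EuclideanSpace ℝ (Fin n) → EuclideanSpace ℝ (Fin n)} {c : ℝ} {p : ChartPt n}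

lemma clm_apply_eq_sum (T : EuclideanSpace ℝ (Fin n) →L[ℝ] EuclideanSpace ℝ (Fin n))
    (y : EuclideanSpace ℝ (Fin n)) (a : Fin n) :
    T y a = ∑ k, T (EuclideanSpace.single k 1) a * y k := by
  have hy : y = ∑ k, y k • EuclideanSpace.single k (1 : ℝ) := by
    ext i
    simp [Pi.single_apply]
  conv_lhs => rw [hy]
  simp [mul_comm]

lemma tangentScale_snd (f : EuclideanSpace ℝ (Fin n) → EuclideanSpace ℝ (Fin n)) (c : ℝ)
    (p : ChartPt n) (a : Fin n) :
    (tangentScale f c p).2 a = c * ∑ k, jac f a k p * p.2 k := by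
  simp only [tangentScale, jac, PiLp.smul_apply, smul_eq_mul]
  rw [clm_apply_eq_sum]

lemma fderiv_eq_sum {u : ChartPt n → ℝ} (q v : ChartPt n) :
    fderiv ℝ u q v = ∑ a, v.1 a * pdx a u q + ∑ b, v.2 b * pdy b u q := by
  have hv : v = ∑ a, v.1 a • ((EuclideanSpace.single a (1 : ℝ), 0) : ChartPt n)
      + ∑ k, v.2 k • ((0, EuclideanSpace.single k (1 : ℝ)) : ChartPt n) := by
    ext i
    · simp [Prod.fst_sum, Pi.single_apply]
    · simp [Prod.snd_sum, Pi.single_apply]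
  conv_lhs => rw [hv]
  simp only [map_add, map_sum, map_smul, smul_eq_mul, pdx, pdy]

lemma fderiv_comp_eq_sum {Φ : ChartPt n → ChartPt n} {u : ChartPt n → ℝ}
    (hΦ : DifferentiableAt ℝ Φ p) (hu : DifferentiableAt ℝ u (Φ p)) (v : ChartPt n) :
    fderiv ℝ (fun q => u (Φ q)) p v =
      ∑ a, fderiv ℝ (fun q => (Φ q).1 a) p v * pdx a u (Φ p)
        + ∑ b, fderiv ℝ (fun q => (Φ q).2 b) p v * pdy b u (Φ p) := by
  have h1 : ∀ a, fderiv ℝ (fun q => (Φ q).1 a) p v = (fderiv ℝ Φ p v).1 a := fun a => by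
    have := (((EuclideanSpace.proj (𝕜 := ℝ) a).comp
      (ContinuousLinearMap.fst ℝ (EuclideanSpace ℝ (Fin n))
        (EuclideanSpace ℝ (Fin n)))).hasFDerivAt.comp p hΦ.hasFDerivAt).fderiv
    exact congrArg (fun T => T v) this
  have h2 : ∀ a, fderiv ℝ (fun q => (Φ q).2 a) p v = (fderiv ℝ Φ p v).2 a := fun a => by
    have := (((EuclideanSpace.proj (𝕜 := ℝ) a).comp
      (ContinuousLinearMap.snd ℝ (EuclideanSpace ℝ (Fin n))
        (EuclideanSpace ℝ (Fin n)))).hasFDerivAt.comp p hΦ.hasFDerivAt).fderiv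
    exact congrArg (fun T => T v) this
  simp only [h1, h2]
  rw [← fderiv_eq_sum]
  have := (hu.hasFDerivAt.comp p hΦ.hasFDerivAt).fderiv
  exact congrArg (fun T => T v) this

lemma contDiffAt_jac (hf : ContDiffAt ℝ ∞ f p.1) (a i : Fin n) :
    ContDiffAt ℝ ∞ (jac f a i) p := by
  have h1 : ContDiffAt ℝ ∞ (fun x => fderiv ℝ f x (EuclideanSpace.single i 1)) p.1 :=
    (hf.fderiv_right (m := ∞) (by simp)).clm_apply contDiffAt_const
  have h2 : ContDiffAt ℝ ∞ (fun q : ChartPt n => fderiv ℝ f q.1 (EuclideanSpace.single i 1)) p :=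
    ContDiffAt.comp p h1 contDiffAt_fst
  exact (EuclideanSpace.proj (𝕜 := ℝ) a).contDiff.contDiffAt.comp p h2

lemma differentiableAt_jac (hf : ContDiffAt ℝ ∞ f p.1) (a i : Fin n) :
    DifferentiableAt ℝ (jac f a i) p :=
  (contDiffAt_jac hf a i).differentiableAt (by simp)

lemma fderiv_comp_fst {u : EuclideanSpace ℝ (Fin n) → ℝ} (hu : DifferentiableAt ℝ u p.1)
    (v : ChartPt n) : fderiv ℝ (fun q : ChartPt n => u q.1) p v = fderiv ℝ u p.1 v.1 := by
  have := (hu.hasFDerivAt.comp p (hasFDerivAt_fst (𝕜 := ℝ))).fderiv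
  exact congrArg (fun T => T v) this

lemma fderiv_euclidean_apply {u : EuclideanSpace ℝ (Fin n) → EuclideanSpace ℝ (Fin n)}
    {x : EuclideanSpace ℝ (Fin n)} (hu : DifferentiableAt ℝ u x) (a : Fin n)
    (v : EuclideanSpace ℝ (Fin n)) : fderiv ℝ (fun z => u z a) x v = fderiv ℝ u x v a := by
  have := ((EuclideanSpace.proj (𝕜 := ℝ) a).hasFDerivAt.comp x hu.hasFDerivAt).fderiv
  exact congrArg (fun T => T v) this

lemma fderiv_jac (hf : ContDiffAt ℝ ∞ f p.1) (a i : Fin n) (v : ChartPt n) :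
    fderiv ℝ (jac f a i) p v = fderiv ℝ (fderiv ℝ f) p.1 v.1 (EuclideanSpace.single i 1) a := by
  have hd : DifferentiableAt ℝ (fderiv ℝ f) p.1 :=
    (hf.fderiv_right (m := ∞) (by simp)).differentiableAt (by simp)
  have hd' : DifferentiableAt ℝ (fun x => fderiv ℝ f x (EuclideanSpace.single i 1)) p.1 :=
    hd.clm_apply (differentiableAt_const _)
  have hd'' : DifferentiableAt ℝ (fun x => fderiv ℝ f x (EuclideanSpace.single i 1) a) p.1 :=
    (EuclideanSpace.proj (𝕜 := ℝ) a).differentiableAt.comp p.1 hd'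
  unfold jac
  rw [fderiv_comp_fst (u := fun x => fderiv ℝ f x (EuclideanSpace.single i 1) a) hd'',
    fderiv_euclidean_apply hd', fderiv_clm_apply hd (differentiableAt_const _)]
  simp

lemma pdy_jac (hf : ContDiffAt ℝ ∞ f p.1) (a i j : Fin n) : pdy j (jac f a i) p = 0 := by
  simp [pdy, fderiv_jac hf]

lemma pdx_jac_symm (hf : ContDiffAt ℝ ∞ f p.1) (a i j : Fin n) :
    pdx j (jac f a i) p = pdx i (jac f a j) p := by
  have hs : IsSymmSndFDerivAt ℝ f p.1 :=
    hf.isSymmSndFDerivAt (by simpa using WithTop.coe_le_coe.2 (le_top : (2 : ℕ∞) ≤ ⊤))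
  simp only [pdx, fderiv_jac hf, hs.eq]

lemma contDiffAt_tangentScale (hf : ContDiffAt ℝ ∞ f p.1) :
    ContDiffAt ℝ ∞ (tangentScale f c) p := by
  have h1 : ContDiffAt ℝ ∞ (fun q : ChartPt n => fderiv ℝ f q.1) p :=
    ContDiffAt.comp p (hf.fderiv_right (m := ∞) (by simp)) contDiffAt_fst
  exact (ContDiffAt.comp p hf contDiffAt_fst).prodMk
    ((h1.clm_apply contDiffAt_snd).const_smul c)

lemma differentiableAt_tangentScale (hf : ContDiffAt ℝ ∞ f p.1) :
    DifferentiableAt ℝ (tangentScale f c) p :=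
  (contDiffAt_tangentScale hf).differentiableAt (by simp)

lemma fderiv_tangentScale_fst (hf : ContDiffAt ℝ ∞ f p.1) (a : Fin n) (v : ChartPt n) :
    fderiv ℝ (fun q => (tangentScale f c q).1 a) p v = fderiv ℝ f p.1 v.1 a := by
  have hd : DifferentiableAt ℝ f p.1 := hf.differentiableAt (by simp)
  have hd' : DifferentiableAt ℝ (fun x => f x a) p.1 :=
    (EuclideanSpace.proj (𝕜 := ℝ) a).differentiableAt.comp p.1 hd
  simp only [tangentScale]
  rw [fderiv_comp_fst (u := fun x => f x a) hd', fderiv_euclidean_apply hd]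

lemma differentiableAt_coord (k : Fin n) : DifferentiableAt ℝ (fun q : ChartPt n => q.2 k) p :=
  (hasFDerivAt_coord k p).differentiableAt

/-- A fibre derivative sees only the linear map `c · Df`, because the base point does not move. -/
lemma pdy_comp_tangentScale {u : ChartPt n → ℝ} (hf : ContDiffAt ℝ ∞ f p.1)
    (hu : DifferentiableAt ℝ u (tangentScale f c p)) (i : Fin n) :
    pdy i (fun q => u (tangentScale f c q)) p =
      c * ∑ a, jac f a i p * pdy a u (tangentScale f c p) := by
  have hm : ∀ b k, DifferentiableAt ℝ (fun q : ChartPt n => jac f b k q * q.2 k) p :=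
    fun b k => (differentiableAt_jac hf b k).mul (differentiableAt_coord k)
  have h2 : ∀ b, pdy i (fun q => (tangentScale f c q).2 b) p = c * jac f b i p := fun b => by
    simp only [tangentScale_snd]
    rw [pdy_const_mul _ _ (DifferentiableAt.fun_sum fun k _ => hm b k), pdy_sum _ fun k _ => hm b k]
    simp only [pdy_mul i (differentiableAt_jac hf b _) (differentiableAt_coord _), pdy_jac hf,
      pdy_coord]
    simp
  have h := fderiv_comp_eq_sum (differentiableAt_tangentScale hf) hu (0, EuclideanSpace.single i 1)
  simp only [fderiv_tangentScale_fst hf, map_zero, PiLp.zero_apply, zero_mul,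
    Finset.sum_const_zero, zero_add] at h
  simp only [pdy] at h h2 ⊢
  simp only [h, h2, mul_assoc, Finset.mul_sum]

/-- Moving the base point also changes `Df`. The resulting Hessian term is the non-tensorial part
that the nonlinear connection has to absorb. -/
lemma pdx_comp_tangentScale {u : ChartPt n → ℝ} (hf : ContDiffAt ℝ ∞ f p.1)
    (hu : DifferentiableAt ℝ u (tangentScale f c p)) (i : Fin n) :
    pdx i (fun q => u (tangentScale f c q)) p =
      ∑ a, jac f a i p * pdx a u (tangentScale f c p)
        + c * ∑ b, hessMul f b i p * pdy b u (tangentScale f c p) := by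
  have hm : ∀ b k, DifferentiableAt ℝ (fun q : ChartPt n => jac f b k q * q.2 k) p :=
    fun b k => (differentiableAt_jac hf b k).mul (differentiableAt_coord k)
  have h2 : ∀ b, pdx i (fun q => (tangentScale f c q).2 b) p = c * hessMul f b i p := fun b => by
    simp only [tangentScale_snd]
    rw [pdx_const_mul _ _ (DifferentiableAt.fun_sum fun k _ => hm b k), pdx_sum _ fun k _ => hm b k]
    simp only [pdx_mul i (differentiableAt_jac hf b _) (differentiableAt_coord _), pdx_coord,
      mul_zero, add_zero, hessMul]
  have h := fderiv_comp_eq_sum (differentiableAt_tangentScale hf) hu (EuclideanSpace.single i 1, 0)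
  simp only [fderiv_tangentScale_fst hf] at h
  simp only [pdx] at h h2 ⊢
  simp only [h, h2, mul_assoc, Finset.mul_sum, jac]

end ChartFinsler

/-! ### Transformation of the metric and the spray. -/

namespace ChartFinsler

variable {n : ℕ} {L L' : ChartPt n → ℝ} {U U' : Set (ChartPt n)}
  {f : EuclideanSpace ℝ (Fin n) → EuclideanSpace ℝ (Fin n)} {c : ℝ} {p : ChartPt n}

lemma pdx_sum_mul {F G : Fin n → ChartPt n → ℝ} (j : Fin n)
    (hF : ∀ i, DifferentiableAt ℝ (F i) p) (hG : ∀ i, DifferentiableAt ℝ (G i) p) :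
    pdx j (fun q => ∑ i, F i q * G i q) p =
      ∑ i, (pdx j (F i) p * G i p + F i p * pdx j (G i) p) := by
  rw [pdx_sum (F := fun i q => F i q * G i q) j fun i _ => (hF i).mul (hG i)]
  simp only [pdx_mul j (hF _) (hG _)]

lemma pdy_sum_mul {F G : Fin n → ChartPt n → ℝ} (j : Fin n)
    (hF : ∀ i, DifferentiableAt ℝ (F i) p) (hG : ∀ i, DifferentiableAt ℝ (G i) p) :
    pdy j (fun q => ∑ i, F i q * G i q) p =
      ∑ i, (pdy j (F i) p * G i p + F i p * pdy j (G i) p) := by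
  rw [pdy_sum (F := fun i q => F i q * G i q) j fun i _ => (hF i).mul (hG i)]
  simp only [pdy_mul j (hF _) (hG _)]

/-- The map `(x, y) ↦ (f(x), c · Df(x) y)` carries `c L` on `U` to `L'` on `U'`. -/
structure IsFinslerMap (L L' : ChartPt n → ℝ) (U U' : Set (ChartPt n))
    (f : EuclideanSpace ℝ (Fin n) → EuclideanSpace ℝ (Fin n)) (c : ℝ) : Prop where
  source : IsFinslerOn L U
  target : IsFinslerOn L' U'
  pos : 0 < c
  mapsTo : ∀ p ∈ U, tangentScale f c p ∈ U'
  smooth : ∀ p ∈ U, ContDiffAt ℝ ∞ f p.1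
  surjective : ∀ p ∈ U, Function.Surjective (fderiv ℝ f p.1)
  map_eq : ∀ p ∈ U, L' (tangentScale f c p) = c * L p

namespace IsFinslerMap

variable (h : IsFinslerMap L L' U U' f c) (hp : p ∈ U)
include h hp

lemma eq_zero_of_sum_jac_mul {W : Fin n → ℝ} (hW : ∀ l, ∑ a, jac f a l p * W a = 0) (b : Fin n) :
    W b = 0 := by
  -- Surjectivity of the Jacobian makes its transpose injective: pairing the hypothesis with a
  -- preimage of `e_b` isolates `W b`.
  obtain ⟨y, hy⟩ := h.surjective p hp (EuclideanSpace.single b 1)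
  have h1 : ∑ l, (∑ a, jac f a l p * W a) * y l = W b := by
    simp only [Finset.sum_mul]
    rw [Finset.sum_comm]
    have h2 : ∀ a, ∑ l, jac f a l p * W a * y l = W a * (if a = b then 1 else 0) := fun a => by
      have h3 : fderiv ℝ f p.1 y a = if a = b then 1 else 0 := by
        rw [hy]
        simp
      rw [← h3, clm_apply_eq_sum, Finset.mul_sum]
      exact Finset.sum_congr rfl fun l _ => by simp only [jac]; ring
    simp [h2]
  rw [← h1]
  simp [hW]

/-- Lowering with the target metric and pulling back by the Jacobian loses nothing. After both
operations `metric_eq` expresses everything through the source metric. -/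
lemma eq_of_sum_jac_mul_sum_metric {X Y : Fin n → ℝ}
    (hXY : ∀ l, ∑ a, jac f a l p * ∑ b, metric L' a b (tangentScale f c p) * X b =
      ∑ a, jac f a l p * ∑ b, metric L' a b (tangentScale f c p) * Y b) (b : Fin n) :
    X b = Y b := by
  refine h.target.eq_of_sum_metric_mul_eq (h.mapsTo p hp) (fun a => ?_) b
  refine sub_eq_zero.1 (h.eq_zero_of_sum_jac_mul hp
    (W := fun a => ∑ b, metric L' a b (tangentScale f c p) * X b
      - ∑ b, metric L' a b (tangentScale f c p) * Y b) (fun l => ?_) a)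
  simp only [mul_sub, Finset.sum_sub_distrib, hXY, sub_self]

lemma eventually_map_sq : (fun q => L' (tangentScale f c q) ^ 2) =ᶠ[nhds p]
    fun q => c ^ 2 * L q ^ 2 :=
  Filter.eventuallyEq_of_mem (h.source.mem_nhds hp) fun q hq => by
    simp only [h.map_eq q hq]
    ring

lemma sum_jac_mul_pdy_sq (l : Fin n) :
    ∑ a, jac f a l p * pdy a (fun q => L' q ^ 2) (tangentScale f c p) =
      c * pdy l (fun q => L q ^ 2) p := by
  have hd := (h.target.contDiffAt_sq (h.mapsTo p hp)).differentiableAt (by simp)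
  have h1 := pdy_comp_tangentScale (h.smooth p hp) hd l
  rw [pdy_congr l (h.eventually_map_sq hp),
    pdy_const_mul _ _ ((h.source.contDiffAt_sq hp).differentiableAt (by simp))] at h1
  have := h.pos.ne'
  refine mul_left_cancel₀ this ?_
  linarith

lemma sum_jac_mul_pdx_sq (l : Fin n) :
    ∑ a, jac f a l p * pdx a (fun q => L' q ^ 2) (tangentScale f c p)
        + c * ∑ b, hessMul f b l p * pdy b (fun q => L' q ^ 2) (tangentScale f c p) =
      c ^ 2 * pdx l (fun q => L q ^ 2) p := by
  have hd := (h.target.contDiffAt_sq (h.mapsTo p hp)).differentiableAt (by simp)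
  have h1 := pdx_comp_tangentScale (h.smooth p hp) hd l
  rw [pdx_congr l (h.eventually_map_sq hp),
    pdx_const_mul _ _ ((h.source.contDiffAt_sq hp).differentiableAt (by simp))] at h1
  exact h1.symm

lemma differentiableAt_comp {u : ChartPt n → ℝ}
    (hu : DifferentiableAt ℝ u (tangentScale f c p)) :
    DifferentiableAt ℝ (fun q => u (tangentScale f c q)) p :=
  hu.comp p (differentiableAt_tangentScale (h.smooth p hp))

lemma eventually_sum_jac_mul_pdy_sq (l : Fin n) :
    (fun q => ∑ a, jac f a l q * pdy a (fun q => L' q ^ 2) (tangentScale f c q)) =ᶠ[nhds p]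
      fun q => c * pdy l (fun q => L q ^ 2) q :=
  Filter.eventuallyEq_of_mem (h.source.mem_nhds hp) fun _ hq => h.sum_jac_mul_pdy_sq hq l

lemma differentiableAt_pdy_sq_target (a : Fin n) :
    DifferentiableAt ℝ (pdy a (fun q => L' q ^ 2)) (tangentScale f c p) :=
  (contDiffAt_pdy a (h.target.contDiffAt_sq (h.mapsTo p hp))).differentiableAt (by simp)

lemma differentiableAt_pdy_sq_source (a : Fin n) :
    DifferentiableAt ℝ (pdy a (fun q => L q ^ 2)) p :=
  (contDiffAt_pdy a (h.source.contDiffAt_sq hp)).differentiableAt (by simp)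

/-- No power of `c` survives: `L'^2` pulls back to `c^2 L^2`, and each of the two fibre derivatives
brings one factor `c`. -/
lemma metric_eq (i j : Fin n) :
    metric L i j p =
      ∑ a, jac f a i p * ∑ b, metric L' a b (tangentScale f c p) * jac f b j p := by
  have hd := h.differentiableAt_pdy_sq_target hp
  have h1 := pdy_congr i (h.eventually_sum_jac_mul_pdy_sq hp j)
  rw [pdy_const_mul _ _ (h.differentiableAt_pdy_sq_source hp j),
    pdy_sum_mul _ (fun a => differentiableAt_jac (h.smooth p hp) a j)
      (fun a => h.differentiableAt_comp hp (hd a))] at h1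
  simp only [pdy_jac (h.smooth p hp), zero_mul, zero_add, pdy_comp_tangentScale (h.smooth p hp) (hd _),
    mul_left_comm _ c, ← Finset.mul_sum] at h1
  have h2 := mul_left_cancel₀ h.pos.ne' h1
  simp only [metric, ← h2, Finset.mul_sum]
  rw [Finset.sum_comm]
  exact Finset.sum_congr rfl fun _ _ => Finset.sum_congr rfl fun _ _ => by ring

/-- The `x`-derivative of `sum_jac_mul_pdy_sq`. The coefficient `2 * c` arises because the fibre
Hessian of `L'^2` is twice the metric. -/
lemma pdx_pdy_sq (k l : Fin n) :
    ∑ a, pdx k (jac f a l) p * pdy a (fun q => L' q ^ 2) (tangentScale f c p)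
      + (∑ a, jac f a l p *
          ∑ b, jac f b k p * pdx b (pdy a (fun q => L' q ^ 2)) (tangentScale f c p))
      + 2 * c * ∑ a, jac f a l p *
          ∑ b, metric L' a b (tangentScale f c p) * hessMul f b k p =
      c * pdx k (pdy l (fun q => L q ^ 2)) p := by
  have hd := h.differentiableAt_pdy_sq_target hp
  have h1 := pdx_congr k (h.eventually_sum_jac_mul_pdy_sq hp l)
  rw [pdx_const_mul _ _ (h.differentiableAt_pdy_sq_source hp l),
    pdx_sum_mul _ (fun a => differentiableAt_jac (h.smooth p hp) a l)
      (fun a => h.differentiableAt_comp hp (hd a))] at h1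
  simp only [pdx_comp_tangentScale (h.smooth p hp) (hd _), mul_add, Finset.sum_add_distrib] at h1
  rw [← h1, add_assoc, add_right_inj, add_right_inj, Finset.mul_sum]
  refine Finset.sum_congr rfl fun a _ => ?_
  simp only [Finset.mul_sum]
  refine Finset.sum_congr rfl fun b _ => ?_
  rw [h.target.metric_symm (h.mapsTo p hp), metric]
  ring

lemma sum_coord_mul_pdx_jac (a l : Fin n) :
    ∑ k, p.2 k * pdx k (jac f a l) p = hessMul f a l p := by
  simp only [hessMul]
  exact Finset.sum_congr rfl fun k _ => by rw [pdx_jac_symm (h.smooth p hp), mul_comm]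

/-- The transformation law of a spray, with the quadratic Hessian term that makes it non-tensorial.
-/
lemma spray_comp (b : Fin n) :
    spray L' b (tangentScale f c p) =
      c ^ 2 * (∑ i, jac f b i p * spray L i p - (1 / 2) * ∑ k, hessMul f b k p * p.2 k) := by
  refine h.eq_of_sum_jac_mul_sum_metric hp (X := fun b => spray L' b (tangentScale f c p))
    (Y := fun b => c ^ 2 * (∑ i, jac f b i p * spray L i p
      - (1 / 2) * ∑ k, hessMul f b k p * p.2 k)) (fun l => ?_) b
  simp only [h.target.sum_metric_mul_spray (h.mapsTo p hp)]
  set Q := tangentScale f c p with hQ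
  have e1 : ∑ a, jac f a l p * ∑ b, metric L' a b Q * ∑ i, jac f b i p * spray L i p
      = ∑ i, metric L l i p * spray L i p := by
    simp only [h.metric_eq hp, Finset.mul_sum, Finset.sum_mul, ← hQ]
    conv_rhs => rw [Finset.sum_comm]
    refine Finset.sum_congr rfl fun a _ => ?_
    rw [Finset.sum_comm]
    exact Finset.sum_congr rfl fun _ _ => Finset.sum_congr rfl fun _ _ => by ring
  have e2 : ∑ a, jac f a l p * ∑ b, metric L' a b Q * (c ^ 2 * (∑ i, jac f b i p * spray L i p
      - (1 / 2) * ∑ k, hessMul f b k p * p.2 k))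
      = c ^ 2 * ∑ i, metric L l i p * spray L i p - c ^ 2 * (1 / 2) *
        ∑ a, jac f a l p * ∑ b, metric L' a b Q * ∑ k, hessMul f b k p * p.2 k := by
    rw [← e1]
    simp only [Finset.mul_sum, mul_sub, Finset.sum_sub_distrib]
    congr 1 <;> exact Finset.sum_congr rfl fun _ _ => Finset.sum_congr rfl fun _ _ =>
      Finset.sum_congr rfl fun _ _ => by ring
  have e3 : ∑ k, p.2 k * (c * pdx k (pdy l (fun q => L q ^ 2)) p)
      = ∑ a, hessMul f a l p * pdy a (fun q => L' q ^ 2) Q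
        + (∑ k, p.2 k * ∑ a, jac f a l p *
          ∑ b, jac f b k p * pdx b (pdy a (fun q => L' q ^ 2)) Q)
        + 2 * c * ∑ a, jac f a l p * ∑ b, metric L' a b Q * ∑ k, hessMul f b k p * p.2 k := by
    simp only [← h.pdx_pdy_sq hp, ← hQ, mul_add, Finset.sum_add_distrib]
    congr 1
    · congr 1
      simp only [← h.sum_coord_mul_pdx_jac hp _ l, Finset.mul_sum, Finset.sum_mul]
      rw [Finset.sum_comm]
      exact Finset.sum_congr rfl fun _ _ => Finset.sum_congr rfl fun _ _ => by ring
    · simp only [Finset.mul_sum]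
      rw [Finset.sum_comm]
      refine Finset.sum_congr rfl fun a _ => ?_
      rw [Finset.sum_comm]
      exact Finset.sum_congr rfl fun _ _ => Finset.sum_congr rfl fun _ _ => by ring
  have e4 : c * ∑ k, p.2 k * ∑ a, jac f a l p *
        ∑ b, jac f b k p * pdx b (pdy a (fun q => L' q ^ 2)) Q
      = ∑ a, jac f a l p * ∑ k, Q.2 k * pdx k (pdy a (fun q => L' q ^ 2)) Q := by
    simp only [hQ, tangentScale_snd, Finset.mul_sum, Finset.sum_mul]
    rw [Finset.sum_comm]
    refine Finset.sum_congr rfl fun a _ => ?_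
    rw [Finset.sum_comm]
    exact Finset.sum_congr rfl fun _ _ => Finset.sum_congr rfl fun _ _ => by ring
  have e5 := h.sum_jac_mul_pdx_sq hp l
  rw [e2, h.source.sum_metric_mul_spray hp]
  simp only [mul_left_comm _ (1 / 4 : ℝ), ← Finset.mul_sum, mul_sub, Finset.sum_sub_distrib]
  simp only [mul_left_comm _ c, ← Finset.mul_sum] at e3
  rw [← hQ] at e5
  -- The terms pairing the Hessian with `∂L'^2/∂y` cancel between `e3` and `e5`; the term with `2 *
  -- c` in `e3` produces the `1/2` of the statement.
  linear_combination -(1 / 4) * e4 - (c / 4) * e3 - (1 / 4) * e5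

end IsFinslerMap

end ChartFinsler

/-! ### Transformation of the nonlinear connection, the Cartan coefficients and one-forms. -/

namespace ChartFinsler

variable {n : ℕ} {L L' : ChartPt n → ℝ} {U U' : Set (ChartPt n)}
  {f : EuclideanSpace ℝ (Fin n) → EuclideanSpace ℝ (Fin n)} {c : ℝ} {p : ChartPt n}

lemma hpd_sum_mul {F G : Fin n → ChartPt n → ℝ} (j : Fin n)
    (hF : ∀ i, DifferentiableAt ℝ (F i) p) (hG : ∀ i, DifferentiableAt ℝ (G i) p) :
    hpd L j (fun q => ∑ i, F i q * G i q) p =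
      ∑ i, (hpd L j (F i) p * G i p + F i p * hpd L j (G i) p) := by
  rw [hpd_sum (F := fun i q => F i q * G i q) j fun i _ => (hF i).mul (hG i)]
  simp only [hpd_mul j (hF _) (hG _)]

lemma hpd_jac (hf : ContDiffAt ℝ ∞ f p.1) (a i j : Fin n) :
    hpd L j (jac f a i) p = pdx j (jac f a i) p := by
  simp [hpd, pdy_jac hf]

namespace IsFinslerMap

variable (h : IsFinslerMap L L' U U' f c) (hp : p ∈ U)
include h hp

lemma contDiffAt_hessMul (b k : Fin n) : ContDiffAt ℝ ∞ (hessMul f b k) p :=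
  ContDiffAt.sum fun _ _ => (contDiffAt_pdx _ (contDiffAt_jac (h.smooth p hp) _ _)).mul
    (contDiff_coord _).contDiffAt

lemma pdy_pdx_jac (b m k j : Fin n) : pdy j (pdx k (jac f b m)) p = 0 := by
  rw [← pdx_pdy_comm _ _ (contDiffAt_jac (h.smooth p hp) _ _),
    pdx_congr (g := fun _ => 0) k (Filter.eventuallyEq_of_mem (h.source.mem_nhds hp) fun q hq =>
      pdy_jac (h.smooth q hq) b m j)]
  simp [pdx]

lemma pdy_hessMul (b k j : Fin n) : pdy j (hessMul f b k) p = pdx k (jac f b j) p := by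
  unfold hessMul
  rw [pdy_sum_mul j (fun m => (contDiffAt_pdx k (contDiffAt_jac (h.smooth p hp) b m)).differentiableAt
    (by simp)) fun m => differentiableAt_coord m]
  simp [h.pdy_pdx_jac hp, pdy_coord]

/-- The fibre derivative of `spray_comp`. -/
lemma nonlin_comp (b j : Fin n) :
    ∑ a, jac f a j p * nonlin L' b a (tangentScale f c p) =
      c * (∑ i, jac f b i p * nonlin L i j p - hessMul f b j p) := by
  have hev : (fun q => spray L' b (tangentScale f c q)) =ᶠ[nhds p] fun q =>
      c ^ 2 * (∑ i, jac f b i q * spray L i q - (1 / 2) * ∑ k, hessMul f b k q * q.2 k) :=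
    Filter.eventuallyEq_of_mem (h.source.mem_nhds hp) fun q hq => h.spray_comp hq b
  have hs : ∀ i, DifferentiableAt ℝ (spray L i) p := fun i =>
    (h.source.contDiffAt_spray hp i).differentiableAt (by simp)
  have hs' : DifferentiableAt ℝ (spray L' b) (tangentScale f c p) :=
    (h.target.contDiffAt_spray (h.mapsTo p hp) b).differentiableAt (by simp)
  have hJ : ∀ i, DifferentiableAt ℝ (jac f b i) p := differentiableAt_jac (h.smooth p hp) b
  have hH : ∀ k, DifferentiableAt ℝ (hessMul f b k) p := fun k =>
    (h.contDiffAt_hessMul hp b k).differentiableAt (by simp)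
  have hd1 : DifferentiableAt ℝ (fun q => ∑ i, jac f b i q * spray L i q) p :=
    DifferentiableAt.fun_sum fun i _ => (hJ i).mul (hs i)
  have hd2 : DifferentiableAt ℝ (fun q : ChartPt n => ∑ k, hessMul f b k q * q.2 k) p :=
    DifferentiableAt.fun_sum fun k _ => (hH k).mul (differentiableAt_coord k)
  have h1 := pdy_congr j hev
  rw [pdy_comp_tangentScale (h.smooth p hp) hs', pdy_const_mul _ _ (hd1.fun_sub (hd2.const_mul _)),
    pdy_sub _ hd1 (hd2.const_mul _), pdy_const_mul _ _ hd2, pdy_sum_mul j hJ hs,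
    pdy_sum_mul j hH differentiableAt_coord] at h1
  -- The derivative of a quadratic form in `y`: symmetry of the Hessian gives the factor two, which
  -- cancels the `1/2`.
  have h2 : ∑ i, (pdy j (hessMul f b i) p * p.2 i
      + hessMul f b i p * pdy j (fun q : ChartPt n => q.2 i) p) = 2 * hessMul f b j p := by
    simp only [h.pdy_hessMul hp, pdy_coord, Finset.sum_add_distrib, mul_ite, mul_one, mul_zero,
      Finset.sum_ite_eq', Finset.mem_univ, if_true, mul_comm (pdx _ _ p),
      h.sum_coord_mul_pdx_jac hp]
    ring
  rw [h2] at h1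
  simp only [pdy_jac (h.smooth p hp), zero_mul, zero_add] at h1
  refine mul_left_cancel₀ h.pos.ne' ?_
  simp only [nonlin]
  rw [h1]
  ring

/-- The Hessian term of `∂/∂x` cancels against the inhomogeneous term of `nonlin_comp`; so the
horizontal fields transform like coordinate vectors, without a factor `c`. -/
lemma hpd_comp {u : ChartPt n → ℝ} (hu : DifferentiableAt ℝ u (tangentScale f c p)) (j : Fin n) :
    hpd L j (fun q => u (tangentScale f c q)) p =
      ∑ a, jac f a j p * hpd L' a u (tangentScale f c p) := by
  simp only [hpd, pdx_comp_tangentScale (h.smooth p hp) hu,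
    pdy_comp_tangentScale (h.smooth p hp) hu]
  have h1 : ∑ a, jac f a j p * ∑ b, nonlin L' b a (tangentScale f c p)
        * pdy b u (tangentScale f c p)
      = ∑ b, (c * (∑ i, jac f b i p * nonlin L i j p - hessMul f b j p))
        * pdy b u (tangentScale f c p) := by
    simp only [← h.nonlin_comp hp, Finset.mul_sum, Finset.sum_mul]
    rw [Finset.sum_comm]
    exact Finset.sum_congr rfl fun _ _ => Finset.sum_congr rfl fun _ _ => by ring
  have h2 : ∑ m, nonlin L m j p * (c * ∑ a, jac f a m p * pdy a u (tangentScale f c p))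
      = ∑ b, (c * ∑ i, jac f b i p * nonlin L i j p) * pdy b u (tangentScale f c p) := by
    simp only [Finset.mul_sum, Finset.sum_mul]
    rw [Finset.sum_comm]
    exact Finset.sum_congr rfl fun _ _ => Finset.sum_congr rfl fun _ _ => by ring
  have h3 : c * ∑ b, hessMul f b j p * pdy b u (tangentScale f c p)
      = ∑ b, (c * hessMul f b j p) * pdy b u (tangentScale f c p) := by
    simp only [Finset.mul_sum, mul_assoc]
  simp only [mul_sub, Finset.sum_sub_distrib, h1, h2, h3, sub_mul]
  ring

lemma hpd_metric_comp (j l k : Fin n) :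
    hpd L j (metric L l k) p =
      (∑ a, ∑ b, pdx j (jac f a l) p * jac f b k p * metric L' a b (tangentScale f c p))
      + (∑ a, ∑ b, jac f a l p * pdx j (jac f b k) p * metric L' a b (tangentScale f c p))
      + ∑ a, ∑ b, ∑ d, jac f a l p * jac f b k p * jac f d j p
          * hpd L' d (metric L' a b) (tangentScale f c p) := by
  have hev : metric L l k =ᶠ[nhds p] fun q =>
      ∑ a, jac f a l q * ∑ b, metric L' a b (tangentScale f c q) * jac f b k q :=
    Filter.eventuallyEq_of_mem (h.source.mem_nhds hp) fun q hq => h.metric_eq hq l k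
  have hJ := differentiableAt_jac (h.smooth p hp)
  have hg : ∀ a b, DifferentiableAt ℝ (metric L' a b) (tangentScale f c p) :=
    h.target.differentiableAt_metric (h.mapsTo p hp)
  have hgc := fun a b => h.differentiableAt_comp hp (hg a b)
  rw [hpd_congr j hev, hpd_sum_mul j (fun a => hJ a l) fun a =>
    DifferentiableAt.fun_sum fun b _ => (hgc a b).fun_mul (hJ b k)]
  simp only [hpd_sum_mul j (fun b => hgc _ b) (fun b => hJ b k), h.hpd_comp hp (hg _ _),
    hpd_jac (h.smooth p hp), ← Finset.sum_add_distrib, Finset.mul_sum, Finset.sum_mul]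
  refine Finset.sum_congr rfl fun a _ => Finset.sum_congr rfl fun b _ => ?_
  rw [mul_add, Finset.mul_sum, add_assoc, add_comm (∑ _, _)]
  congr 1
  · ring
  · congr 1
    · ring
    · exact Finset.sum_congr rfl fun _ _ => by ring

/-- The classical law for Christoffel symbols. Of the six second-derivative terms in the alternating
sum, four cancel in pairs and two agree, which uses up the factor `1/2`. -/
lemma hCoeff_comp (e j k : Fin n) :
    ∑ i, jac f e i p * hCoeff L i j k p =
      (∑ d, ∑ b, hCoeff L' e d b (tangentScale f c p) * jac f d j p * jac f b k p)
        + pdx j (jac f e k) p := by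
  refine h.eq_of_sum_jac_mul_sum_metric hp (X := fun e => ∑ i, jac f e i p * hCoeff L i j k p)
    (Y := fun e => (∑ d, ∑ b, hCoeff L' e d b (tangentScale f c p) * jac f d j p * jac f b k p)
      + pdx j (jac f e k) p) (fun l => ?_) e
  have hQ := h.mapsTo p hp
  set Q := tangentScale f c p with hQdef
  have e1 : ∑ a, jac f a l p * ∑ b, metric L' a b Q * ∑ i, jac f b i p * hCoeff L i j k p
      = ∑ i, metric L l i p * hCoeff L i j k p := by
    simp only [h.metric_eq hp, Finset.mul_sum, Finset.sum_mul, ← hQdef]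
    conv_rhs => rw [Finset.sum_comm]
    refine Finset.sum_congr rfl fun a _ => ?_
    rw [Finset.sum_comm]
    exact Finset.sum_congr rfl fun _ _ => Finset.sum_congr rfl fun _ _ => by ring
  have e2 : ∀ a, ∑ e, metric L' a e Q * ∑ d, ∑ b, hCoeff L' e d b Q * jac f d j p * jac f b k p
      = ∑ d, ∑ b, (jac f d j p * jac f b k p) * ((1 / 2) * (hpd L' d (metric L' a b) Q
        + hpd L' b (metric L' a d) Q - hpd L' a (metric L' d b) Q)) := fun a => by
    simp only [← h.target.sum_metric_mul_hCoeff hQ, Finset.mul_sum]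
    rw [Finset.sum_comm]
    refine Finset.sum_congr rfl fun d _ => ?_
    rw [Finset.sum_comm]
    exact Finset.sum_congr rfl fun _ _ => Finset.sum_congr rfl fun _ _ => by ring
  rw [e1, h.source.sum_metric_mul_hCoeff hp]
  simp only [mul_add, Finset.sum_add_distrib, e2]
  simp only [h.hpd_metric_comp hp, ← hQdef]
  -- the terms containing second derivatives of `f`
  have s1 : ∑ a, ∑ b, pdx k (jac f a l) p * jac f b j p * metric L' a b Q
      = ∑ a, ∑ b, jac f a j p * pdx l (jac f b k) p * metric L' a b Q := by
    rw [Finset.sum_comm]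
    exact Finset.sum_congr rfl fun a _ => Finset.sum_congr rfl fun b _ => by
      rw [h.target.metric_symm hQ, pdx_jac_symm (h.smooth p hp)]; ring
  have s2 : ∑ a, ∑ b, pdx j (jac f a l) p * jac f b k p * metric L' a b Q
      = ∑ a, ∑ b, pdx l (jac f a j) p * jac f b k p * metric L' a b Q :=
    Finset.sum_congr rfl fun a _ => Finset.sum_congr rfl fun b _ => by
      rw [pdx_jac_symm (h.smooth p hp)]
  have s3 : ∑ a, ∑ b, jac f a l p * pdx k (jac f b j) p * metric L' a b Q
      = ∑ a, ∑ b, jac f a l p * pdx j (jac f b k) p * metric L' a b Q :=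
    Finset.sum_congr rfl fun a _ => Finset.sum_congr rfl fun b _ => by
      rw [pdx_jac_symm (h.smooth p hp)]
  have s4 : ∑ a, jac f a l p * ∑ b, metric L' a b Q * pdx j (jac f b k) p
      = ∑ a, ∑ b, jac f a l p * pdx j (jac f b k) p * metric L' a b Q := by
    simp only [Finset.mul_sum]
    exact Finset.sum_congr rfl fun a _ => Finset.sum_congr rfl fun b _ => by ring
  -- the terms containing derivatives of the metric
  have t0 : ∑ a, jac f a l p * ∑ d, ∑ b, (jac f d j p * jac f b k p) * ((1 / 2) *
        (hpd L' d (metric L' a b) Q + hpd L' b (metric L' a d) Q - hpd L' a (metric L' d b) Q))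
      = (1 / 2) * ((∑ a, ∑ d, ∑ b, jac f a l p * (jac f d j p * jac f b k p)
            * hpd L' d (metric L' a b) Q)
        + (∑ a, ∑ d, ∑ b, jac f a l p * (jac f d j p * jac f b k p)
            * hpd L' b (metric L' a d) Q)
        - ∑ a, ∑ d, ∑ b, jac f a l p * (jac f d j p * jac f b k p)
            * hpd L' a (metric L' d b) Q) := by
    simp only [Finset.mul_sum, ← Finset.sum_add_distrib, ← Finset.sum_sub_distrib]
    exact Finset.sum_congr rfl fun _ _ => Finset.sum_congr rfl fun _ _ =>
      Finset.sum_congr rfl fun _ _ => by ring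
  have t1 : ∑ a, ∑ b, ∑ d, jac f a l p * jac f b k p * jac f d j p * hpd L' d (metric L' a b) Q
      = ∑ a, ∑ d, ∑ b, jac f a l p * (jac f d j p * jac f b k p)
          * hpd L' d (metric L' a b) Q := by
    refine Finset.sum_congr rfl fun a _ => ?_
    rw [Finset.sum_comm]
    exact Finset.sum_congr rfl fun _ _ => Finset.sum_congr rfl fun _ _ => by ring
  have t2 : ∑ a, ∑ b, ∑ d, jac f a l p * jac f b j p * jac f d k p * hpd L' d (metric L' a b) Q
      = ∑ a, ∑ d, ∑ b, jac f a l p * (jac f d j p * jac f b k p)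
          * hpd L' b (metric L' a d) Q :=
    Finset.sum_congr rfl fun _ _ => Finset.sum_congr rfl fun _ _ =>
      Finset.sum_congr rfl fun _ _ => by ring
  have t3 : ∑ a, ∑ b, ∑ d, jac f a j p * jac f b k p * jac f d l p * hpd L' d (metric L' a b) Q
      = ∑ a, ∑ d, ∑ b, jac f a l p * (jac f d j p * jac f b k p)
          * hpd L' a (metric L' d b) Q := by
    conv_lhs => enter [2, a]; rw [Finset.sum_comm]
    rw [Finset.sum_comm]
    exact Finset.sum_congr rfl fun _ _ => Finset.sum_congr rfl fun _ _ =>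
      Finset.sum_congr rfl fun _ _ => by ring
  rw [s1, s2, s3, s4, t0, t1, t2, t3]
  ring

/-- The horizontal covariant derivative of a one-form is a tensor. -/
lemma hCov1_comp {a a' : Fin n → ChartPt n → ℝ}
    (ha : ∀ q ∈ U, ∀ i, a i q = ∑ b, jac f b i q * a' b (tangentScale f c q))
    (ha' : ∀ b, DifferentiableAt ℝ (a' b) (tangentScale f c p)) (i m : Fin n) :
    hCov1 L a i m p = ∑ b, ∑ d, jac f b i p * jac f d m p * hCov1 L' a' b d (tangentScale f c p) := by
  have hev : a i =ᶠ[nhds p] fun q => ∑ b, jac f b i q * a' b (tangentScale f c q) :=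
    Filter.eventuallyEq_of_mem (h.source.mem_nhds hp) fun q hq => ha q hq i
  have h1 : ∑ s, hCoeff L s m i p * a s p =
      ∑ b, (∑ s, jac f b s p * hCoeff L s m i p) * a' b (tangentScale f c p) := by
    simp only [ha p hp, Finset.mul_sum, Finset.sum_mul]
    rw [Finset.sum_comm]
    exact Finset.sum_congr rfl fun _ _ => Finset.sum_congr rfl fun _ _ => by ring
  have h2 : ∑ b, (∑ d, ∑ e, hCoeff L' b d e (tangentScale f c p) * jac f d m p * jac f e i p)
        * a' b (tangentScale f c p)
      = ∑ b, ∑ d, jac f b i p * jac f d m p * ∑ s, hCoeff L' s d b (tangentScale f c p)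
        * a' s (tangentScale f c p) := by
    simp only [Finset.mul_sum, Finset.sum_mul]
    conv_lhs => rw [Finset.sum_comm]
    conv_rhs => rw [Finset.sum_comm]
    refine Finset.sum_congr rfl fun d _ => ?_
    rw [Finset.sum_comm]
    exact Finset.sum_congr rfl fun _ _ => Finset.sum_congr rfl fun _ _ => by ring
  rw [hCov1, h1, hpd_congr m hev, hpd_sum_mul m (fun b => differentiableAt_jac (h.smooth p hp) b i)
    fun b => h.differentiableAt_comp hp (ha' b)]
  -- The derivative of the Jacobian in the law for `a` is the inhomogeneous term of `hCoeff_comp`,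
  -- and the two cancel.
  simp only [h.hCoeff_comp hp, add_mul, Finset.sum_add_distrib, hpd_jac (h.smooth p hp), h2, hCov1,
    mul_sub, Finset.sum_sub_distrib, h.hpd_comp hp (ha' _)]
  have h3 : ∑ b, jac f b i p * ∑ d, jac f d m p * hpd L' d (a' b) (tangentScale f c p)
      = ∑ b, ∑ d, jac f b i p * jac f d m p * hpd L' d (a' b) (tangentScale f c p) := by
    simp only [Finset.mul_sum, mul_assoc]
  rw [h3]
  ring

end IsFinslerMap

end ChartFinsler

/-! ### Homogeneity, vanishing deflection, and the case `R̂ = 0`. -/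

namespace ChartFinsler

variable {n : ℕ} {L : ChartPt n → ℝ} {U : Set (ChartPt n)} {p : ChartPt n}

/-- `L` is a Finsler function, positively homogeneous of degree one, on the open conic set `U`. -/
structure IsConicFinslerOn (L : ChartPt n → ℝ) (U : Set (ChartPt n)) : Prop
    extends IsFinslerOn L U where
  conic : ∀ p ∈ U, ∀ c : ℝ, 0 < c → (p.1, c • p.2) ∈ U
  homogeneous : ∀ p ∈ U, ∀ c : ℝ, 0 < c → L (p.1, c • p.2) = c * L p

lemma tangentScale_id (c : ℝ) (p : ChartPt n) : tangentScale id c p = (p.1, c • p.2) := by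
  simp [tangentScale]

lemma jac_id (a i : Fin n) (p : ChartPt n) : jac id a i p = if a = i then 1 else 0 := by
  simp [jac]

lemma hessMul_id (a i : Fin n) (p : ChartPt n) : hessMul id a i p = 0 := by
  have h : ∀ m, jac (n := n) id a m = fun _ => if a = m then 1 else 0 := fun m => by
    ext q
    exact jac_id a m q
  simp [hessMul, h, pdx]

namespace IsConicFinslerOn

variable (h : IsConicFinslerOn L U) (hp : p ∈ U)
include h

/-- Fibre scaling is a special case of the maps above, so each transformation law specializes to a
homogeneity law. -/
lemma isFinslerMap_id {c : ℝ} (hc : 0 < c) : IsFinslerMap L L U U id c where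
  source := h.toIsFinslerOn
  target := h.toIsFinslerOn
  pos := hc
  mapsTo p hp := by
    rw [tangentScale_id]
    exact h.conic p hp c hc
  smooth _ _ := contDiff_id.contDiffAt
  surjective p _ := by
    rw [fderiv_id]
    exact Function.surjective_id
  map_eq p hp := by
    rw [tangentScale_id]
    exact h.homogeneous p hp c hc

include hp

lemma pdy_sq_homogeneous (l : Fin n) {c : ℝ} (hc : 0 < c) :
    pdy l (fun q => L q ^ 2) (p.1, c • p.2) = c * pdy l (fun q => L q ^ 2) p := by
  simpa [jac_id, tangentScale_id] using (h.isFinslerMap_id hc).sum_jac_mul_pdy_sq hp l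

lemma spray_homogeneous (b : Fin n) {c : ℝ} (hc : 0 < c) :
    spray L b (p.1, c • p.2) = c ^ 2 * spray L b p := by
  simpa [jac_id, tangentScale_id, hessMul_id] using (h.isFinslerMap_id hc).spray_comp hp b

lemma hCov1_homogeneous {a : Fin n → ChartPt n → ℝ}
    (ha : ∀ q ∈ U, ∀ c : ℝ, 0 < c → ∀ i, a i (q.1, c • q.2) = a i q)
    (hd : ∀ q ∈ U, ∀ i, DifferentiableAt ℝ (a i) q) (i m : Fin n) {c : ℝ} (hc : 0 < c) :
    hCov1 L a i m (p.1, c • p.2) = hCov1 L a i m p := by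
  have := (h.isFinslerMap_id hc).hCov1_comp hp (a := a) (a' := a)
    (fun q hq i => by simp [jac_id, tangentScale_id, ha q hq c hc])
    (fun b => hd _ ((h.isFinslerMap_id hc).mapsTo p hp) b) i m
  simpa [jac_id, tangentScale_id] using this.symm

lemma sum_coord_mul_nonlin (i : Fin n) : ∑ k, p.2 k * nonlin L i k p = 2 * spray L i p := by
  simpa [nonlin] using sum_coord_mul_pdy 2
    ((h.contDiffAt_spray hp i).differentiableAt (by simp))
    (fun c hc => h.spray_homogeneous hp i hc)

lemma sum_metric_mul_coord (l : Fin n) :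
    ∑ k, metric L l k p * p.2 k = (1 / 2) * pdy l (fun q => L q ^ 2) p := by
  have h1 := sum_coord_mul_pdy 1
    ((contDiffAt_pdy l (h.contDiffAt_sq hp)).differentiableAt (by simp))
    (fun c hc => by rw [h.pdy_sq_homogeneous hp l hc, pow_one])
  rw [Nat.cast_one, one_mul] at h1
  rw [← h1, Finset.mul_sum]
  exact Finset.sum_congr rfl fun k _ => by
    rw [h.metric_symm hp, metric]
    ring

/-- Apply `δ_j` to `sum_metric_mul_coord`. Since `δ_j y^k = -N^k_j`, the terms with `N` on the two
sides agree, leaving only an `x`-derivative. -/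
lemma sum_hpd_metric_mul_coord (j l : Fin n) :
    ∑ k, hpd L j (metric L l k) p * p.2 k =
      (1 / 2) * pdx j (pdy l (fun q => L q ^ 2)) p := by
  have hev : (fun q : ChartPt n => ∑ k, metric L l k q * q.2 k) =ᶠ[nhds p]
      fun q => (1 / 2) * pdy l (fun q => L q ^ 2) q :=
    Filter.eventuallyEq_of_mem (h.mem_nhds hp) fun q hq => h.sum_metric_mul_coord hq l
  have h1 := hpd_congr (L := L) j hev
  rw [hpd_sum_mul j (h.differentiableAt_metric hp l) differentiableAt_coord,
    hpd_const_mul _ _ ((contDiffAt_pdy l (h.contDiffAt_sq hp)).differentiableAt (by simp))] at h1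
  simp only [hpd_coord, Finset.sum_add_distrib] at h1
  have h2 : ∑ k, metric L l k p * -nonlin L k j p =
      -((1 / 2) * ∑ m, nonlin L m j p * pdy m (pdy l fun q => L q ^ 2) p) := by
    rw [Finset.mul_sum, ← Finset.sum_neg_distrib]
    exact Finset.sum_congr rfl fun k _ => by
      rw [h.metric_symm hp, metric]
      ring
  rw [h2, hpd] at h1
  linarith

/-- The Cartan tensor is totally symmetric, being a third fibre derivative of `L^2` up to a
constant. -/
lemma pdy_metric_symm (i j k : Fin n) : pdy i (metric L j k) p = pdy k (metric L j i) p := by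
  have hd := fun i j => (contDiffAt_pdy i (contDiffAt_pdy j (h.contDiffAt_sq hp))).differentiableAt
    (n := ∞) (by simp)
  have h0 : pdy k (metric L j i) p = pdy k (metric L i j) p :=
    pdy_congr _ (Filter.eventuallyEq_of_mem (h.mem_nhds hp) fun q hq => h.metric_symm hq _ _)
  have h1 : pdy i (metric L j k) p = pdy i (metric L k j) p :=
    pdy_congr _ (Filter.eventuallyEq_of_mem (h.mem_nhds hp) fun q hq => h.metric_symm hq _ _)
  rw [h0, h1]
  unfold metric
  rw [pdy_const_mul _ _ (hd _ _), pdy_const_mul _ _ (hd _ _),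
    pdy_pdy_comm _ _ (contDiffAt_pdy _ (h.contDiffAt_sq hp))]

/-- The Cartan connection has vanishing deflection. -/
lemma sum_hCoeff_mul_coord (i j : Fin n) :
    ∑ k, hCoeff L i j k p * p.2 k = nonlin L i j p := by
  refine h.eq_of_sum_metric_mul_eq hp (X := fun i => ∑ k, hCoeff L i j k p * p.2 k)
    (Y := fun i => nonlin L i j p) (fun l => ?_) i
  have hF := h.contDiffAt_sq hp
  have hdF := fun k => (contDiffAt_pdx k (contDiffAt_pdy l hF)).differentiableAt (n := ∞) (by simp)
  have e1 : ∑ i, metric L l i p * ∑ k, hCoeff L i j k p * p.2 k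
      = (1 / 2) * ((∑ k, hpd L j (metric L l k) p * p.2 k)
        + (∑ k, p.2 k * hpd L k (metric L l j) p) - ∑ k, hpd L l (metric L j k) p * p.2 k) := by
    simp only [Finset.mul_sum]
    rw [Finset.sum_comm]
    simp only [← mul_assoc, ← Finset.sum_mul, h.sum_metric_mul_hCoeff hp,
      ← Finset.sum_add_distrib, ← Finset.sum_sub_distrib, Finset.mul_sum]
    exact Finset.sum_congr rfl fun _ _ => by ring
  have e2 : ∑ k, p.2 k * hpd L k (metric L l j) p
      = (∑ k, p.2 k * pdx k (metric L l j) p) - 2 * ∑ m, spray L m p * pdy m (metric L l j) p := by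
    simp only [hpd, mul_sub, Finset.sum_sub_distrib]
    congr 1
    rw [Finset.mul_sum]
    simp only [← mul_assoc, ← h.sum_coord_mul_nonlin hp, Finset.sum_mul, Finset.mul_sum]
    rw [Finset.sum_comm]
  -- The fibre derivative of the lowered spray is the lowered `N` plus a Cartan tensor term; `e5`
  -- identifies that term with the one in `e2`.
  have hev : (fun q => ∑ i, metric L l i q * spray L i q) =ᶠ[nhds p] fun q =>
      (1 / 4) * ((∑ k, q.2 k * pdx k (pdy l (fun q => L q ^ 2)) q)
        - pdx l (fun q => L q ^ 2) q) :=
    Filter.eventuallyEq_of_mem (h.mem_nhds hp) fun q hq => h.sum_metric_mul_spray hq l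
  have hd1 : DifferentiableAt ℝ
      (fun q : ChartPt n => ∑ k, q.2 k * pdx k (pdy l (fun q => L q ^ 2)) q) p :=
    DifferentiableAt.fun_sum fun k _ => (differentiableAt_coord k).fun_mul (hdF k)
  have hd2 : DifferentiableAt ℝ (pdx l (fun q => L q ^ 2)) p :=
    (contDiffAt_pdx l hF).differentiableAt (by simp)
  have e3 := pdy_congr j hev
  rw [pdy_sum_mul j (h.differentiableAt_metric hp l)
      (fun i => (h.contDiffAt_spray hp i).differentiableAt (by simp)),
    pdy_const_mul _ _ (hd1.fun_sub hd2), pdy_sub _ hd1 hd2,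
    pdy_sum_mul j differentiableAt_coord hdF] at e3
  have e4 : ∀ k, pdy j (pdx k (pdy l fun q => L q ^ 2)) p = 2 * pdx k (metric L l j) p := by
    intro k
    have : pdx k (metric L l j) p = pdx k (metric L j l) p :=
      pdx_congr _ (Filter.eventuallyEq_of_mem (h.mem_nhds hp) fun q hq => h.metric_symm hq _ _)
    rw [this, ← pdx_pdy_comm _ _ (contDiffAt_pdy l hF)]
    unfold metric
    rw [pdx_const_mul _ _ ((contDiffAt_pdy j (contDiffAt_pdy l hF)).differentiableAt (by simp))]
    ring
  simp only [pdy_coord, e4, Finset.sum_add_distrib, ite_mul, one_mul, zero_mul,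
    Finset.sum_ite_eq', Finset.mem_univ, if_true, mul_left_comm _ (2 : ℝ), ← Finset.mul_sum,
    ← pdx_pdy_comm _ _ hF] at e3
  have e5 : ∑ i, pdy j (metric L l i) p * spray L i p
      = ∑ m, spray L m p * pdy m (metric L l j) p :=
    Finset.sum_congr rfl fun m _ => by rw [h.pdy_metric_symm hp m l j, mul_comm]
  rw [e1, e2, h.sum_hpd_metric_mul_coord hp, h.sum_hpd_metric_mul_coord hp]
  simp only [nonlin]
  rw [e5] at e3
  linarith

/-- If `R̂ = 0`, then `∇R` is annihilated by `η` as well. -/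
lemma sum_hCov13_hCurv_mul_coord (hR : ∀ q ∈ U, ∀ i k l, hCurvHat L i k l q = 0)
    (m i k l : Fin n) : ∑ j, hCov13 L (hCurv L) m i j k l p * p.2 j = 0 := by
  have h0 : hpd L m (fun q => ∑ j, hCurv L i j k l q * q.2 j) p = 0 := by
    rw [hpd_congr (f := fun q => ∑ j, hCurv L i j k l q * q.2 j) m (g := fun _ => 0)
      (Filter.eventuallyEq_of_mem (h.mem_nhds hp) fun q hq => hR q hq i k l), hpd_const]
  rw [hpd_sum_mul m (fun j => h.differentiableAt_hCurv hp i j k l) differentiableAt_coord] at h0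
  simp only [hpd_coord, Finset.sum_add_distrib] at h0
  have hR' : ∀ i k l, ∑ j, hCurv L i j k l p * p.2 j = 0 := hR p hp
  have e1 : ∑ j, (∑ s, hCoeff L i m s p * hCurv L s j k l p) * p.2 j = 0 := by
    simp only [Finset.sum_mul, mul_assoc]
    rw [Finset.sum_comm]
    simp [← Finset.mul_sum, hR']
  have e2 : ∑ j, (∑ s, hCoeff L s m k p * hCurv L i j s l p) * p.2 j = 0 := by
    simp only [Finset.sum_mul, mul_assoc]
    rw [Finset.sum_comm]
    simp [← Finset.mul_sum, hR']
  have e3 : ∑ j, (∑ s, hCoeff L s m l p * hCurv L i j k s p) * p.2 j = 0 := by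
    simp only [Finset.sum_mul, mul_assoc]
    rw [Finset.sum_comm]
    simp [← Finset.mul_sum, hR']
  -- Vanishing deflection enters here: the connection term of the slot filled with `η` offsets `δ_m
  -- y^j = -N^j_m`.
  have e4 : ∑ j, (∑ s, hCoeff L s m j p * hCurv L i s k l p) * p.2 j
      = -∑ s, hCurv L i s k l p * -nonlin L s m p := by
    simp only [← h.sum_hCoeff_mul_coord hp, Finset.sum_mul, mul_neg, Finset.sum_neg_distrib,
      neg_neg, Finset.mul_sum]
    rw [Finset.sum_comm]
    exact Finset.sum_congr rfl fun _ _ => Finset.sum_congr rfl fun _ _ => by ring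
  simp only [hCov13, add_mul, sub_mul, Finset.sum_add_distrib, Finset.sum_sub_distrib, e1, e2, e3,
    e4]
  linarith

/-- Inserting `η` removes both curvature terms and leaves `b_m G(·,·)η = 0`. Nondegeneracy gives a
`k` with `g(∂_k, η) ≠ 0`. -/
lemma eq_zero_of_hCurvHat_eq_zero (hn : 2 ≤ n) (hy : p.2 ≠ 0)
    (hR : ∀ q ∈ U, ∀ i k l, hCurvHat L i k l q = 0) {a b : Fin n → ChartPt n → ℝ} {m : Fin n}
    (hrec : ∀ i j k l, hCov13 L (hCurv L) m i j k l p =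
      a m p * hCurv L i j k l p + b m p * tensorG L i j k l p) : b m p = 0 := by
  obtain ⟨k, hk⟩ : ∃ k, ∑ j, metric L k j p * p.2 j ≠ 0 := by
    by_contra! hc
    refine hy (PiLp.ext fun i => ?_)
    exact h.eq_of_sum_metric_mul_eq hp (X := fun i => p.2 i) (Y := fun _ => 0)
      (fun a => by simp [hc a]) i
  have : Nontrivial (Fin n) := Fin.nontrivial_iff_two_le.2 hn
  -- For `l ≠ k`, the `l`-th component of `G(∂_k, ∂_l)η` is just `g(∂_k, η)`.
  obtain ⟨l, hl⟩ := exists_ne k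
  have h1 := h.sum_hCov13_hCurv_mul_coord hp hR m l k l
  have hR' : ∑ j, hCurv L l j k l p * p.2 j = 0 := hR p hp l k l
  simp only [hrec, add_mul, Finset.sum_add_distrib, mul_assoc, ← Finset.mul_sum, hR', mul_zero,
    zero_add, tensorG, if_true, if_neg hl, one_mul, sub_zero] at h1
  exact (mul_eq_zero.1 h1).resolve_right hk

end IsConicFinslerOn

end ChartFinsler

section Manifold

open ChartFinsler

variable {n : ℕ} {M : Type*} [TopologicalSpace M] [ChartedSpace (EuclideanSpace ℝ (Fin n)) M]
  [IsManifold (𝓡 n) ∞ M] {φ ψ : OpenPartialHomeomorph M (EuclideanSpace ℝ (Fin n))} {p : ChartPt n}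

/-! ### Charts of the tangent bundle -/

omit [IsManifold (𝓡 n) ∞ M] [ChartedSpace (EuclideanSpace ℝ (Fin n)) M] in
lemma isOpen_slitDomain (φ : OpenPartialHomeomorph M (EuclideanSpace ℝ (Fin n))) :
    IsOpen (slitDomain φ) :=
  (φ.open_target.preimage continuous_fst).inter (isOpen_ne_fun continuous_snd continuous_const)

omit [IsManifold (𝓡 n) ∞ M] [ChartedSpace (EuclideanSpace ℝ (Fin n)) M] in
lemma smul_mem_slitDomain (hp : p ∈ slitDomain φ) {c : ℝ} (hc : 0 < c) :
    ((p.1, c • p.2) : ChartPt n) ∈ slitDomain φ :=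
  ⟨hp.1, smul_ne_zero hc.ne' hp.2⟩

/-- The derivative of the chart `φ`, in terms of the model space. -/
def chartDeriv (φ : OpenPartialHomeomorph M (EuclideanSpace ℝ (Fin n))) (m : M) :
    EuclideanSpace ℝ (Fin n) →L[ℝ] EuclideanSpace ℝ (Fin n) :=
  mfderiv (𝓡 n) (𝓡 n) φ m

/-- The derivative of the inverse of the chart `φ`, in terms of the model space. -/
def symmDeriv (φ : OpenPartialHomeomorph M (EuclideanSpace ℝ (Fin n)))
    (x : EuclideanSpace ℝ (Fin n)) : EuclideanSpace ℝ (Fin n) →L[ℝ] EuclideanSpace ℝ (Fin n) :=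
  mfderiv (𝓡 n) (𝓡 n) φ.symm x

omit [IsManifold (𝓡 n) ∞ M] in
lemma chartVec_eq (φ : OpenPartialHomeomorph M (EuclideanSpace ℝ (Fin n))) (p : ChartPt n) :
    chartVec φ p = ⟨φ.symm p.1, symmDeriv φ p.1 p.2⟩ := rfl

omit [IsManifold (𝓡 n) ∞ M] in
lemma chartVec_smul (φ : OpenPartialHomeomorph M (EuclideanSpace ℝ (Fin n))) (p : ChartPt n)
    (c : ℝ) : chartVec φ (p.1, c • p.2) = ⟨(chartVec φ p).1, c • (chartVec φ p).2⟩ := by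
  rw [chartVec_eq, map_smul]
  rfl

lemma chart_mdifferentiable (hφ : φ ∈ atlas (EuclideanSpace ℝ (Fin n)) M) :
    φ.MDifferentiable (𝓡 n) (𝓡 n) :=
  haveI : IsManifold (𝓡 n) 1 M := IsManifold.of_le (n := ∞) (by simp)
  mdifferentiable_of_mem_atlas hφ

lemma symmDeriv_chartDeriv (hφ : φ ∈ atlas (EuclideanSpace ℝ (Fin n)) M) {m : M}
    (hm : m ∈ φ.source) (v : EuclideanSpace ℝ (Fin n)) :
    symmDeriv φ (φ m) (chartDeriv φ m v) = v :=
  congrArg (fun T => T v) ((chart_mdifferentiable hφ).symm_comp_deriv hm)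

lemma chartDeriv_symmDeriv (hφ : φ ∈ atlas (EuclideanSpace ℝ (Fin n)) M)
    {x : EuclideanSpace ℝ (Fin n)} (hx : x ∈ φ.target) (v : EuclideanSpace ℝ (Fin n)) :
    chartDeriv φ (φ.symm x) (symmDeriv φ x v) = v :=
  congrArg (fun T => T v) ((chart_mdifferentiable hφ).comp_symm_deriv hx)

lemma chartVec_snd_ne_zero (hφ : φ ∈ atlas (EuclideanSpace ℝ (Fin n)) M)
    (hp : p ∈ slitDomain φ) : (chartVec φ p).2 ≠ 0 := by
  intro h0
  have h1 : symmDeriv φ p.1 p.2 = 0 := h0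
  refine hp.2 ?_
  rw [← chartDeriv_symmDeriv hφ hp.1 p.2, h1, map_zero]

lemma contMDiffOn_symm_of_mem_atlas (hφ : φ ∈ atlas (EuclideanSpace ℝ (Fin n)) M) :
    ContMDiffOn (𝓡 n) (𝓡 n) ∞ φ.symm φ.target :=
  contMDiffOn_symm_of_mem_maximalAtlas (IsManifold.subset_maximalAtlas hφ)

/-- This map is the tangent map of `φ.symm` under the identification of the tangent bundle of the
model space with a product. -/
lemma contMDiffOn_chartVec (hφ : φ ∈ atlas (EuclideanSpace ℝ (Fin n)) M) :
    ContMDiffOn (𝓡 n).tangent (𝓡 n).tangent ∞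
      (fun p : ModelProd (EuclideanSpace ℝ (Fin n)) (EuclideanSpace ℝ (Fin n)) => chartVec φ p)
      {p | p.1 ∈ φ.target} := by
  have h1 := (contMDiffOn_symm_of_mem_atlas hφ).contMDiffOn_tangentMapWithin (m := ∞) (by simp)
    φ.open_target.uniqueMDiffOn
  have h2 := (contMDiff_tangentBundleModelSpaceHomeomorph_symm (I := 𝓡 n) (n := ∞))
  have h3 : ({p | p.1 ∈ φ.target} : Set (ModelProd (EuclideanSpace ℝ (Fin n))
      (EuclideanSpace ℝ (Fin n)))) ⊆ (tangentBundleModelSpaceHomeomorph (𝓡 n)).symm ⁻¹'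
        (Bundle.TotalSpace.proj ⁻¹' φ.target) := fun p hp => hp
  refine (h1.comp h2.contMDiffOn h3).congr fun p hp => ?_
  have : mfderivWithin (𝓡 n) (𝓡 n) φ.symm φ.target p.1 = mfderiv (𝓡 n) (𝓡 n) φ.symm p.1 :=
    mfderivWithin_of_isOpen φ.open_target hp
  simp only [chartVec, Function.comp, tangentMapWithin]
  erw [this]
  rfl

namespace FinslerStructure

variable (L : FinslerStructure n M)

lemma contDiffOn_inChart (hφ : φ ∈ atlas (EuclideanSpace ℝ (Fin n)) M) :
    ContDiffOn ℝ ∞ (L.inChart φ) (slitDomain φ) := by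
  have hsub : slitDomain φ ⊆ {p | p.1 ∈ φ.target} := fun p hp => hp.1
  have h1 := L.smooth_toFun.comp ((contMDiffOn_chartVec hφ).mono hsub)
    fun p hp => chartVec_snd_ne_zero hφ hp
  have h2 : ContMDiffOn 𝓘(ℝ, ChartPt n) 𝓘(ℝ, ℝ) ∞ (L.inChart φ) (slitDomain φ) := by
    rw [modelWithCornersSelf_prod]
    exact h1
  exact h2.contDiffOn

lemma isConicFinslerOn (hφ : φ ∈ atlas (EuclideanSpace ℝ (Fin n)) M) :
    IsConicFinslerOn (L.inChart φ) (slitDomain φ) where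
  isOpen := isOpen_slitDomain φ
  smooth := L.contDiffOn_inChart hφ
  posDef p hp := L.posDef φ hφ p hp
  conic p hp c hc := smul_mem_slitDomain hp hc
  homogeneous p hp c hc := by
    simp only [inChart, chartVec_smul]
    exact L.homogeneous _ c hc

end FinslerStructure

/-! ### Coordinate changes -/

/-- The coordinate change from the chart `ψ` to the chart `φ`. -/
def coordChange (ψ φ : OpenPartialHomeomorph M (EuclideanSpace ℝ (Fin n)))
    (x : EuclideanSpace ℝ (Fin n)) : EuclideanSpace ℝ (Fin n) := φ (ψ.symm x)

/-- The part of the slit domain of `ψ` over the domain of `φ`. -/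
def slitOverlap (ψ φ : OpenPartialHomeomorph M (EuclideanSpace ℝ (Fin n))) : Set (ChartPt n) :=
  {p ∈ slitDomain ψ | ψ.symm p.1 ∈ φ.source}

omit [IsManifold (𝓡 n) ∞ M] [ChartedSpace (EuclideanSpace ℝ (Fin n)) M] in
lemma isOpen_slitOverlap (ψ φ : OpenPartialHomeomorph M (EuclideanSpace ℝ (Fin n))) :
    IsOpen (slitOverlap ψ φ) := by
  have h : IsOpen (ψ.target ∩ ψ.symm ⁻¹' φ.source) :=
    ψ.symm.isOpen_inter_preimage φ.open_source
  have : slitOverlap ψ φ = Prod.fst ⁻¹' (ψ.target ∩ ψ.symm ⁻¹' φ.source) ∩ slitDomain ψ := by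
    ext p
    simp only [slitOverlap, slitDomain, Set.mem_ofPred_eq, Set.mem_inter_iff, Set.mem_preimage]
    tauto
  rw [this]
  exact (h.preimage continuous_fst).inter (isOpen_slitDomain ψ)

lemma contDiffAt_coordChange (hψ : ψ ∈ atlas (EuclideanSpace ℝ (Fin n)) M)
    (hφ : φ ∈ atlas (EuclideanSpace ℝ (Fin n)) M) {x : EuclideanSpace ℝ (Fin n)}
    (hx : x ∈ ψ.target) (hx' : ψ.symm x ∈ φ.source) : ContDiffAt ℝ ∞ (coordChange ψ φ) x := by
  have h1 : ContMDiffAt (𝓡 n) (𝓡 n) ∞ ψ.symm x :=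
    (contMDiffOn_symm_of_mem_atlas hψ).contMDiffAt (ψ.open_target.mem_nhds hx)
  have h2 : ContMDiffAt (𝓡 n) (𝓡 n) ∞ φ (ψ.symm x) :=
    (contMDiffOn_of_mem_maximalAtlas (IsManifold.subset_maximalAtlas hφ)).contMDiffAt
      (φ.open_source.mem_nhds hx')
  exact (h2.comp x h1).contDiffAt

/-- The chain rule for the derivative of a coordinate change. -/
lemma fderiv_coordChange (hψ : ψ ∈ atlas (EuclideanSpace ℝ (Fin n)) M)
    (hφ : φ ∈ atlas (EuclideanSpace ℝ (Fin n)) M) {x : EuclideanSpace ℝ (Fin n)}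
    (hx : x ∈ ψ.target) (hx' : ψ.symm x ∈ φ.source) (v : EuclideanSpace ℝ (Fin n)) :
    fderiv ℝ (coordChange ψ φ) x v = chartDeriv φ (ψ.symm x) (symmDeriv ψ x v) := by
  have h1 := mfderiv_comp x ((chart_mdifferentiable hφ).mdifferentiableAt hx')
    ((chart_mdifferentiable hψ).mdifferentiableAt_symm hx)
  rw [← mfderiv_eq_fderiv]
  exact congrArg (fun T => T v) h1

lemma symmDeriv_fderiv_coordChange (hψ : ψ ∈ atlas (EuclideanSpace ℝ (Fin n)) M)
    (hφ : φ ∈ atlas (EuclideanSpace ℝ (Fin n)) M) {x : EuclideanSpace ℝ (Fin n)}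
    (hx : x ∈ ψ.target) (hx' : ψ.symm x ∈ φ.source) (v : EuclideanSpace ℝ (Fin n)) :
    symmDeriv φ (coordChange ψ φ x) (fderiv ℝ (coordChange ψ φ) x v) = symmDeriv ψ x v := by
  rw [fderiv_coordChange hψ hφ hx hx', coordChange, symmDeriv_chartDeriv hφ hx']

/-- The chain rule gives injectivity, which suffices for an endomorphism of a finite-dimensional
space. -/
lemma fderiv_coordChange_surjective (hψ : ψ ∈ atlas (EuclideanSpace ℝ (Fin n)) M)
    (hφ : φ ∈ atlas (EuclideanSpace ℝ (Fin n)) M) {x : EuclideanSpace ℝ (Fin n)}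
    (hx : x ∈ ψ.target) (hx' : ψ.symm x ∈ φ.source) :
    Function.Surjective (fderiv ℝ (coordChange ψ φ) x) := by
  refine LinearMap.surjective_of_injective (f := (fderiv ℝ (coordChange ψ φ) x).toLinearMap)
    fun v w hvw => ?_
  have hvw' : fderiv ℝ (coordChange ψ φ) x v = fderiv ℝ (coordChange ψ φ) x w := hvw
  rw [← chartDeriv_symmDeriv hψ hx v, ← chartDeriv_symmDeriv hψ hx w,
    ← symmDeriv_fderiv_coordChange hψ hφ hx hx' v, ← symmDeriv_fderiv_coordChange hψ hφ hx hx' w,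
    hvw']

lemma chartVec_coordChange (hψ : ψ ∈ atlas (EuclideanSpace ℝ (Fin n)) M)
    (hφ : φ ∈ atlas (EuclideanSpace ℝ (Fin n)) M) (hp : p ∈ slitOverlap ψ φ) :
    chartVec φ (tangentScale (coordChange ψ φ) 1 p) = chartVec ψ p := by
  rw [chartVec_eq, chartVec_eq]
  refine Bundle.TotalSpace.ext (φ.left_inv hp.2) (heq_of_eq ?_)
  simp only [tangentScale, one_smul]
  exact symmDeriv_fderiv_coordChange hψ hφ hp.1.1 hp.2 p.2

lemma tangentScale_coordChange_mem (hψ : ψ ∈ atlas (EuclideanSpace ℝ (Fin n)) M)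
    (hφ : φ ∈ atlas (EuclideanSpace ℝ (Fin n)) M) (hp : p ∈ slitOverlap ψ φ) :
    tangentScale (coordChange ψ φ) 1 p ∈ slitDomain φ := by
  refine ⟨φ.map_source hp.2, fun h0 => hp.1.2 ?_⟩
  simp only [tangentScale, one_smul] at h0
  rw [← chartDeriv_symmDeriv hψ hp.1.1 p.2, ← symmDeriv_fderiv_coordChange hψ hφ hp.1.1 hp.2, h0,
    map_zero, map_zero]

/-- The two chart expressions evaluate the same function at the same tangent vector, by
`chartVec_coordChange`. -/
lemma FinslerStructure.isFinslerMap_coordChange (L : FinslerStructure n M)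
    (hψ : ψ ∈ atlas (EuclideanSpace ℝ (Fin n)) M)
    (hφ : φ ∈ atlas (EuclideanSpace ℝ (Fin n)) M) :
    IsFinslerMap (L.inChart ψ) (L.inChart φ) (slitOverlap ψ φ) (slitDomain φ)
      (coordChange ψ φ) 1 where
  source :=
    { isOpen := isOpen_slitOverlap ψ φ
      smooth := (L.contDiffOn_inChart hψ).mono fun _ hp => hp.1
      posDef := fun p hp => L.posDef ψ hψ p hp.1 }
  target := (L.isConicFinslerOn hφ).toIsFinslerOn
  pos := one_pos
  mapsTo p hp := tangentScale_coordChange_mem hψ hφ hp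
  smooth p hp := contDiffAt_coordChange hψ hφ hp.1.1 hp.2
  surjective p hp := fderiv_coordChange_surjective hψ hφ hp.1.1 hp.2
  map_eq p hp := by
    rw [inChart, chartVec_coordChange hψ hφ hp, one_mul, inChart]

end Manifold

section Forms

open ChartFinsler

variable {n : ℕ} {M : Type*} [TopologicalSpace M] [ChartedSpace (EuclideanSpace ℝ (Fin n)) M]
  [IsManifold (𝓡 n) ∞ M] {φ ψ : OpenPartialHomeomorph M (EuclideanSpace ℝ (Fin n))} {p : ChartPt n}

/-! ### Components of π-forms -/

/-- The coordinates of a tangent vector in the preferred chart at its base point. -/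
def chartCoord (u : TangentBundle (𝓡 n) M) : ChartPt n :=
  (chartAt (EuclideanSpace ℝ (Fin n)) u.1 u.1,
    chartDeriv (chartAt (EuclideanSpace ℝ (Fin n)) u.1) u.1 u.2)

lemma chartVec_chartCoord (u : TangentBundle (𝓡 n) M) :
    chartVec (chartAt (EuclideanSpace ℝ (Fin n)) u.1) (chartCoord u) = u := by
  rw [chartVec_eq]
  exact Bundle.TotalSpace.ext ((chartAt _ u.1).left_inv (mem_chart_source _ u.1))
    (heq_of_eq (symmDeriv_chartDeriv (chart_mem_atlas _ u.1) (mem_chart_source _ u.1) u.2))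

lemma chartCoord_mem_slitDomain {u : TangentBundle (𝓡 n) M} (hu : u.2 ≠ 0) :
    chartCoord u ∈ slitDomain (chartAt (EuclideanSpace ℝ (Fin n)) u.1) := by
  refine ⟨(chartAt _ u.1).map_source (mem_chart_source _ u.1), fun h0 => hu ?_⟩
  have h1 := symmDeriv_chartDeriv (chart_mem_atlas (EuclideanSpace ℝ (Fin n)) u.1)
    (mem_chart_source _ u.1) u.2
  have h2 : chartDeriv (chartAt (EuclideanSpace ℝ (Fin n)) u.1) u.1 u.2 = 0 := h0
  rw [← h1, h2, map_zero]
  rfl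

omit [IsManifold (𝓡 n) ∞ M] in
lemma chartVec_smul_eq {A : (u : TangentBundle (𝓡 n) M) → EuclideanSpace ℝ (Fin n) → ℝ}
    (hA : ∀ u : TangentBundle (𝓡 n) M, u.2 ≠ 0 → ∀ c : ℝ, 0 < c → A ⟨u.1, c • u.2⟩ = A u)
    (hu : (chartVec φ p).2 ≠ 0) {c : ℝ} (hc : 0 < c) (v : EuclideanSpace ℝ (Fin n)) :
    A (chartVec φ (p.1, c • p.2)) v = A (chartVec φ p) v := by
  rw [chartVec_smul, hA _ hu c hc]

namespace PiOneForm

variable (A : PiOneForm n M)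

omit [IsManifold (𝓡 n) ∞ M] in
lemma contDiffAt_comp (hφ : φ ∈ atlas (EuclideanSpace ℝ (Fin n)) M) (hp : p ∈ slitDomain φ)
    (i : Fin n) : ContDiffAt ℝ ∞ (A.comp φ i) p :=
  (A.smooth_toFun φ hφ i).contDiffAt ((isOpen_slitDomain φ).mem_nhds hp)

omit [IsManifold (𝓡 n) ∞ M] in
lemma differentiableAt_comp (hφ : φ ∈ atlas (EuclideanSpace ℝ (Fin n)) M)
    (hp : p ∈ slitDomain φ) (i : Fin n) : DifferentiableAt ℝ (A.comp φ i) p :=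
  (A.contDiffAt_comp hφ hp i).differentiableAt (by simp)

lemma comp_smul (hφ : φ ∈ atlas (EuclideanSpace ℝ (Fin n)) M) (hp : p ∈ slitDomain φ)
    {c : ℝ} (hc : 0 < c) (i : Fin n) : A.comp φ i (p.1, c • p.2) = A.comp φ i p :=
  chartVec_smul_eq (A := fun u v => A.toFun u v)
    (fun u hu c hc => congrArg (fun T v => T v) (A.homogeneous u hu c hc))
    (chartVec_snd_ne_zero hφ hp) hc (symmDeriv φ p.1 (EuclideanSpace.single i 1))

/-- The transformation law of the components of a π-one-form. -/
lemma comp_coordChange (hψ : ψ ∈ atlas (EuclideanSpace ℝ (Fin n)) M)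
    (hφ : φ ∈ atlas (EuclideanSpace ℝ (Fin n)) M) (hp : p ∈ slitOverlap ψ φ) (i : Fin n) :
    A.comp ψ i p = ∑ b, jac (coordChange ψ φ) b i p *
      A.comp φ b (tangentScale (coordChange ψ φ) 1 p) := by
  -- Every fibre is the model space, so the base vector can be replaced by an equal one with `w`
  -- held fixed.
  have hA : ∀ u v : TangentBundle (𝓡 n) M, u = v → ∀ w : EuclideanSpace ℝ (Fin n),
      A.toFun u w = A.toFun v w := by
    rintro u _ rfl w
    rfl
  have h1 : A.comp ψ i p = A.toFun (chartVec φ (tangentScale (coordChange ψ φ) 1 p))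
      (symmDeriv ψ p.1 (EuclideanSpace.single i 1)) :=
    hA _ _ (chartVec_coordChange hψ hφ hp).symm _
  have h2 : symmDeriv ψ p.1 (EuclideanSpace.single i 1) =
      ∑ b, jac (coordChange ψ φ) b i p •
        symmDeriv φ (coordChange ψ φ p.1) (EuclideanSpace.single b 1) := by
    have hv : fderiv ℝ (coordChange ψ φ) p.1 (EuclideanSpace.single i 1) =
        ∑ b, jac (coordChange ψ φ) b i p • EuclideanSpace.single b (1 : ℝ) := by
      ext a
      simp [jac, Pi.single_apply]
    rw [← symmDeriv_fderiv_coordChange hψ hφ hp.1.1 hp.2, hv, map_sum]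
    simp only [map_smul]
  rw [h1, h2]
  refine (map_sum (A.toFun (chartVec φ (tangentScale (coordChange ψ φ) 1 p))) _ _).trans ?_
  exact Finset.sum_congr rfl fun b _ => map_smul _ _ _

/-- The coordinate vectors of the preferred chart span the fibre, so a form with zero components
there would vanish. -/
lemma Nonzero.exists_comp_ne_zero {A : PiOneForm n M} (hA : A.Nonzero) :
    ∃ φ ∈ atlas (EuclideanSpace ℝ (Fin n)) M, ∃ p ∈ slitDomain φ, ∃ i, A.comp φ i p ≠ 0 := by
  obtain ⟨u, hu, hAu⟩ := hA
  refine ⟨chartAt _ u.1, chart_mem_atlas _ _, chartCoord u, chartCoord_mem_slitDomain hu, ?_⟩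
  by_contra! hc
  refine hAu ?_
  rw [← chartVec_chartCoord u]
  set φ := chartAt (EuclideanSpace ℝ (Fin n)) u.1
  set p := chartCoord u
  have hp := chartCoord_mem_slitDomain hu
  refine LinearMap.ext fun (v : EuclideanSpace ℝ (Fin n)) => ?_
  have hv : v = ∑ b, (chartDeriv φ (φ.symm p.1) v) b •
      symmDeriv φ p.1 (EuclideanSpace.single b 1) := by
    have h1 : chartDeriv φ (φ.symm p.1) v =
        ∑ b, (chartDeriv φ (φ.symm p.1) v) b • EuclideanSpace.single b (1 : ℝ) := by
      ext a
      simp [Pi.single_apply]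
    have h2 := symmDeriv_chartDeriv (chart_mem_atlas _ u.1) (φ.map_target hp.1) v
    rw [φ.right_inv hp.1, h1, map_sum] at h2
    simp only [map_smul] at h2
    exact h2.symm
  rw [hv]
  refine (map_sum (A.toFun (chartVec φ p)) _ _).trans (Finset.sum_eq_zero fun b _ => ?_)
  refine (map_smul (A.toFun (chartVec φ p)) _ _).trans ?_
  have : A.toFun (chartVec φ p) (symmDeriv φ p.1 (EuclideanSpace.single b 1)) = 0 := hc b
  rw [this, smul_zero]

/-- A multiple of a π-one-form. -/
def constSMul (c : ℝ) (A : PiOneForm n M) : PiOneForm n M where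
  toFun u := c • A.toFun u
  smooth_toFun φ hφ i := contDiffOn_const.mul (A.smooth_toFun φ hφ i)
  homogeneous u hu r hr := by rw [A.homogeneous u hu r hr]

omit [IsManifold (𝓡 n) ∞ M] in
lemma comp_constSMul (c : ℝ) (φ : OpenPartialHomeomorph M (EuclideanSpace ℝ (Fin n)))
    (i : Fin n) (p : ChartPt n) : (A.constSMul c).comp φ i p = c * A.comp φ i p := rfl

omit [IsManifold (𝓡 n) ∞ M] in
lemma Nonzero.constSMul {A : PiOneForm n M} (hA : A.Nonzero) {c : ℝ} (hc : c ≠ 0) :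
    (A.constSMul c).Nonzero :=
  let ⟨u, hu, hAu⟩ := hA
  ⟨u, hu, smul_ne_zero hc hAu⟩

end PiOneForm

/-- A compatible family of components of a π-two-form, one for each chart. -/
structure PiTwoFormComponents (n : ℕ) (M : Type*) [TopologicalSpace M]
    [ChartedSpace (EuclideanSpace ℝ (Fin n)) M] where
  /-- The components in a chart. -/
  comp : OpenPartialHomeomorph M (EuclideanSpace ℝ (Fin n)) → Fin n → Fin n → ChartPt n → ℝ
  smooth : ∀ φ ∈ atlas (EuclideanSpace ℝ (Fin n)) M, ∀ i j,
    ContDiffOn ℝ ∞ (comp φ i j) (slitDomain φ)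
  homogeneous : ∀ φ ∈ atlas (EuclideanSpace ℝ (Fin n)) M, ∀ p ∈ slitDomain φ, ∀ c : ℝ, 0 < c →
    ∀ i j, comp φ i j (p.1, c • p.2) = comp φ i j p
  transform : ∀ ψ ∈ atlas (EuclideanSpace ℝ (Fin n)) M,
    ∀ φ ∈ atlas (EuclideanSpace ℝ (Fin n)) M, ∀ p ∈ slitOverlap ψ φ, ∀ i j,
    comp ψ i j p = ∑ a, ∑ b, jac (coordChange ψ φ) a i p * jac (coordChange ψ φ) b j p *
      comp φ a b (tangentScale (coordChange ψ φ) 1 p)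

namespace PiTwoFormComponents

variable (C : PiTwoFormComponents n M)

/-- The `i`-th coordinate differential of the preferred chart at the base point of `u`. -/
def coordForm (u : TangentBundle (𝓡 n) M) (i : Fin n) : TangentSpace (𝓡 n) u.1 →ₗ[ℝ] ℝ :=
  ((EuclideanSpace.proj i).comp
    (chartDeriv (chartAt (EuclideanSpace ℝ (Fin n)) u.1) u.1)).toLinearMap

/-- The bilinear form with the given components in the preferred chart. -/
def bilin (u : TangentBundle (𝓡 n) M) :
    TangentSpace (𝓡 n) u.1 →ₗ[ℝ] TangentSpace (𝓡 n) u.1 →ₗ[ℝ] ℝ :=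
  ∑ a, ∑ b, C.comp (chartAt _ u.1) a b (chartCoord u) •
    (coordForm u a).smulRight (coordForm u b)

omit [IsManifold (𝓡 n) ∞ M] in
lemma bilin_apply (u : TangentBundle (𝓡 n) M) (v w : EuclideanSpace ℝ (Fin n)) :
    C.bilin u v w = ∑ a, ∑ b, C.comp (chartAt _ u.1) a b (chartCoord u) *
      ((chartDeriv (chartAt (EuclideanSpace ℝ (Fin n)) u.1) u.1 v) a *
        (chartDeriv (chartAt (EuclideanSpace ℝ (Fin n)) u.1) u.1 w) b) := by
  have h : ∀ (S : Fin n → Fin n → EuclideanSpace ℝ (Fin n) →ₗ[ℝ] EuclideanSpace ℝ (Fin n) →ₗ[ℝ] ℝ),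
      (∑ a, ∑ b, S a b) v w = ∑ a, ∑ b, S a b v w := fun S => by
    simp [LinearMap.sum_apply]
  exact h _

/-- The transformation law makes `bilin` independent of the preferred chart used to define it. -/
lemma bilin_chartVec (hφ : φ ∈ atlas (EuclideanSpace ℝ (Fin n)) M) (hp : p ∈ slitDomain φ)
    (i j : Fin n) :
    C.bilin (chartVec φ p) (chartBasisVec φ p i) (chartBasisVec φ p j) = C.comp φ i j p := by
  refine (C.bilin_apply _ (symmDeriv φ p.1 (EuclideanSpace.single i 1))
    (symmDeriv φ p.1 (EuclideanSpace.single j 1))).trans ?_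
  have hc := chart_mem_atlas (EuclideanSpace ℝ (Fin n)) (φ.symm p.1)
  have hs := mem_chart_source (EuclideanSpace ℝ (Fin n)) (φ.symm p.1)
  rw [C.transform φ hφ (chartAt _ (φ.symm p.1)) hc p ⟨hp, hs⟩]
  have h1 : chartCoord (chartVec φ p) =
      tangentScale (coordChange φ (chartAt _ (φ.symm p.1))) 1 p := by
    simp only [tangentScale, one_smul, fderiv_coordChange hφ hc hp.1 hs]
    rfl
  refine Finset.sum_congr rfl fun a _ => Finset.sum_congr rfl fun b _ => ?_
  rw [h1, mul_comm]
  simp only [jac, fderiv_coordChange hφ hc hp.1 hs]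
  rfl

lemma bilin_homogeneous (u : TangentBundle (𝓡 n) M) (hu : u.2 ≠ 0) (c : ℝ) (hc : 0 < c) :
    C.bilin ⟨u.1, c • u.2⟩ = C.bilin u := by
  have h1 : chartCoord (⟨u.1, c • u.2⟩ : TangentBundle (𝓡 n) M) =
      ((chartCoord u).1, c • (chartCoord u).2) :=
    Prod.ext rfl (map_smul (chartDeriv (chartAt (EuclideanSpace ℝ (Fin n)) u.1) u.1) c u.2)
  have h2 := C.homogeneous _ (chart_mem_atlas _ u.1) _ (chartCoord_mem_slitDomain hu) c hc
  simp only [bilin, h1, h2]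
  rfl

/-- The π-two-form with the given components. -/
def toPiTwoForm : PiTwoForm n M where
  toFun := C.bilin
  smooth_toFun φ hφ i j := (C.smooth φ hφ i j).congr fun _ hp => C.bilin_chartVec hφ hp i j
  homogeneous := C.bilin_homogeneous

lemma comp_toPiTwoForm (hφ : φ ∈ atlas (EuclideanSpace ℝ (Fin n)) M) (hp : p ∈ slitDomain φ)
    (i j : Fin n) : C.toPiTwoForm.comp φ i j p = C.comp φ i j p :=
  C.bilin_chartVec hφ hp i j

lemma toPiTwoForm_nonzero (hφ : φ ∈ atlas (EuclideanSpace ℝ (Fin n)) M)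
    (hp : p ∈ slitDomain φ) {i j : Fin n} (h : C.comp φ i j p ≠ 0) : C.toPiTwoForm.Nonzero := by
  refine ⟨chartVec φ p, chartVec_snd_ne_zero hφ hp, fun h0 => h ?_⟩
  rw [← C.comp_toPiTwoForm hφ hp, PiTwoForm.comp, h0]
  rfl

end PiTwoFormComponents

/-! ### The two-forms `∇B + A ⊗ B` and the assertions of the theorem. -/

namespace FinslerStructure

variable (L : FinslerStructure n M) (A B : PiOneForm n M)

/-- The components of the π-two-form `∇B + A ⊗ B`. -/
def derivAddTensor : PiTwoFormComponents n M where
  comp φ i j p := hCov1 (L.inChart φ) (B.comp φ) i j p + A.comp φ i p * B.comp φ j p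
  smooth φ hφ i j p hp := by
    have hB := fun i => B.contDiffAt_comp hφ hp i
    exact (((L.isConicFinslerOn hφ).contDiffAt_hCov1 hp hB i j).add
      ((A.contDiffAt_comp hφ hp i).mul (hB j))).contDiffWithinAt
  homogeneous φ hφ p hp c hc i j := by
    rw [A.comp_smul hφ hp hc, B.comp_smul hφ hp hc, (L.isConicFinslerOn hφ).hCov1_homogeneous hp
      (fun q hq c hc i => B.comp_smul hφ hq hc i) (fun q hq i => B.differentiableAt_comp hφ hq i)
      i j hc]
  transform ψ hψ φ hφ p hp i j := by
    rw [(L.isFinslerMap_coordChange hψ hφ).hCov1_comp hp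
      (fun q hq i => B.comp_coordChange hψ hφ hq i)
      (fun b => B.differentiableAt_comp hφ (tangentScale_coordChange_mem hψ hφ hp) b),
      A.comp_coordChange hψ hφ hp, B.comp_coordChange hψ hφ hp, Finset.sum_mul_sum]
    simp only [mul_add, Finset.sum_add_distrib]
    congr 1
    exact Finset.sum_congr rfl fun _ _ => Finset.sum_congr rfl fun _ _ => by ring

variable {L A B}

lemma DerivAddTensorNonzero.toPiTwoForm_nonzero (h : L.DerivAddTensorNonzero A B) :
    (L.derivAddTensor A B).toPiTwoForm.Nonzero :=
  let ⟨_, hφ, _, hp, _, _, hne⟩ := h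
  (L.derivAddTensor A B).toPiTwoForm_nonzero hφ hp hne

namespace IsGeneralizedRecurrentWith

lemma isGeneralizedTwoRecurrent (h : L.IsGeneralizedRecurrentWith A B)
    (hA : L.DerivAddTensorNonzero A A) (hB : L.DerivAddTensorNonzero A B) :
    L.IsGeneralizedTwoRecurrent := by
  refine ⟨h.1, (L.derivAddTensor A A).toPiTwoForm, (L.derivAddTensor A B).toPiTwoForm,
    hA.toPiTwoForm_nonzero, hB.toPiTwoForm_nonzero, fun φ hφ p hp m q i j k l => ?_⟩
  have hL := (L.isConicFinslerOn hφ).toIsFinslerOn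
  rw [PiTwoFormComponents.comp_toPiTwoForm _ hφ hp, PiTwoFormComponents.comp_toPiTwoForm _ hφ hp]
  exact hL.hCov13Second_of_recurrent hp (hL.differentiableAt_hCurv hp)
    (hL.differentiableAt_tensorG hp) (A.differentiableAt_comp hφ hp)
    (B.differentiableAt_comp hφ hp) (hL.hCov13_tensorG hp) (h.2.2.2 φ hφ) m q i j k l

lemma hCov13_concircular (hn : 3 ≤ n) (h : L.IsGeneralizedRecurrentWith A B)
    (hφ : φ ∈ atlas (EuclideanSpace ℝ (Fin n)) M) (hp : p ∈ slitDomain φ) (m i j k l : Fin n) :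
    hCov13 (L.inChart φ) (concircular (L.inChart φ)) m i j k l p =
      A.comp φ m p * concircular (L.inChart φ) i j k l p :=
  (L.isConicFinslerOn hφ).hCov13_concircular_of_recurrent hp hn (h.2.2.2 φ hφ p hp m) i j k l

lemma isConcircularlyRecurrent (hn : 3 ≤ n) (h : L.IsGeneralizedRecurrentWith A B)
    (hC : L.ConcircularNonzero) : L.IsConcircularlyRecurrent :=
  ⟨hC, A, h.2.1, fun _ hφ _ hp => h.hCov13_concircular hn hφ hp⟩

lemma isTwoConcircularlyRecurrent (hn : 3 ≤ n) (h : L.IsGeneralizedRecurrentWith A B)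
    (hC : L.ConcircularNonzero) (hA : L.DerivAddTensorNonzero A A) :
    L.IsTwoConcircularlyRecurrent := by
  refine ⟨hC, (L.derivAddTensor A A).toPiTwoForm, hA.toPiTwoForm_nonzero,
    fun φ hφ p hp m q i j k l => ?_⟩
  have hL := (L.isConicFinslerOn hφ).toIsFinslerOn
  -- `C` satisfies the recurrence equation with second form zero, so the parallel tensor paired with
  -- it is immaterial.
  have h1 := hL.hCov13Second_of_recurrent hp (hL.differentiableAt_concircular hp)
    (hL.differentiableAt_tensorG hp) (b := fun _ _ => 0) (A.differentiableAt_comp hφ hp)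
    (fun _ => differentiableAt_const _) (hL.hCov13_tensorG hp)
    (fun q hq m i j k l => by rw [h.hCov13_concircular hn hφ hq, zero_mul, add_zero]) m q i j k l
  have h2 : hCov1 (L.inChart φ) (fun _ _ => 0) m q p = 0 := by
    simp [hCov1, hpd_const]
  rw [h1, PiTwoFormComponents.comp_toPiTwoForm _ hφ hp, h2, mul_zero, add_zero, zero_mul, add_zero]
  rfl

lemma hCov2_ricci (h : L.IsGeneralizedRecurrentWith A B)
    (hφ : φ ∈ atlas (EuclideanSpace ℝ (Fin n)) M) (hp : p ∈ slitDomain φ) (m i j : Fin n) :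
    hCov2 (L.inChart φ) (ricci (L.inChart φ)) i j m p =
      A.comp φ m p * ricci (L.inChart φ) i j p +
        (B.constSMul ((n : ℝ) - 1)).comp φ m p * metric (L.inChart φ) i j p :=
  (L.isConicFinslerOn hφ).hCov2_ricci_of_recurrent hp (h.2.2.2 φ hφ p hp m) i j

/-- If Ric vanished, its equation at a point with `B_m ≠ 0`, read in the component `(m, m)`, would
give `(n-1) B_m g_mm = 0`, although `g_mm > 0`. -/
lemma ricciNonzero (hn : 3 ≤ n) (h : L.IsGeneralizedRecurrentWith A B) : L.RicciNonzero := by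
  have hn' : (3 : ℝ) ≤ n := by exact_mod_cast hn
  obtain ⟨φ, hφ, p, hp, m, hm⟩ := h.2.2.1.exists_comp_ne_zero
  have hL := L.isConicFinslerOn hφ
  by_contra hR
  have hR0 : ∀ q ∈ slitDomain φ, ∀ i j, ricci (L.inChart φ) i j q = 0 := by
    intro q hq i j
    by_contra hne
    exact hR ⟨φ, hφ, q, hq, i, j, hne⟩
  have h1 := h.hCov2_ricci hφ hp m m m
  have h2 : hpd (L.inChart φ) m (ricci (L.inChart φ) m m) p = 0 := by
    rw [hpd_congr m (g := fun _ => 0) (Filter.eventuallyEq_of_mem (hL.mem_nhds hp)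
      fun q hq => hR0 q hq m m), hpd_const]
  simp only [hCov2, h2, hR0 p hp, mul_zero, Finset.sum_const_zero, sub_zero, zero_add,
    PiOneForm.comp_constSMul] at h1
  have hg : 0 < metric (L.inChart φ) m m p := (hL.posDef p hp).diag_pos (i := m)
  exact mul_ne_zero (mul_ne_zero (by linarith) hm) hg.ne' h1.symm

lemma isGeneralizedRicciRecurrent (hn : 3 ≤ n) (h : L.IsGeneralizedRecurrentWith A B) :
    L.IsGeneralizedRicciRecurrent := by
  have hn' : (3 : ℝ) ≤ n := by exact_mod_cast hn
  exact ⟨h.ricciNonzero hn, A, B.constSMul ((n : ℝ) - 1), h.2.1,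
    h.2.2.1.constSMul (by linarith), fun _ hφ _ hp => h.hCov2_ricci hφ hp⟩

lemma isRecurrent (hn : 3 ≤ n) (h : L.IsGeneralizedRecurrentWith A B) (hR : L.CurvHatZero) :
    L.IsRecurrent := by
  refine ⟨h.1, A, h.2.1, fun φ hφ p hp m i j k l => ?_⟩
  have hB : B.comp φ m p = 0 := (L.isConicFinslerOn hφ).eq_zero_of_hCurvHat_eq_zero hp
    (by omega) hp.2 (hR φ hφ) (h.2.2.2 φ hφ p hp m)
  rw [h.2.2.2 φ hφ p hp, hB, zero_mul, add_zero]

end IsGeneralizedRecurrentWith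

end FinslerStructure

end Forms

end

theorem mainTheorem3 {n : ℕ} (hn : 3 ≤ n) {M : Type*} [TopologicalSpace M]
    [ChartedSpace (EuclideanSpace ℝ (Fin n)) M] [IsManifold (𝓡 n) ∞ M]
    (L : FinslerStructure n M) (A B : PiOneForm n M)
    (hAB : L.IsGeneralizedRecurrentWith A B) :
    (L.DerivAddTensorNonzero A A → L.DerivAddTensorNonzero A B → L.IsGeneralizedTwoRecurrent) ∧
    (L.ConcircularNonzero → L.ScalarCurvNonzero → L.IsConcircularlyRecurrent) ∧
    (L.ConcircularNonzero → L.DerivAddTensorNonzero A A → L.ScalarCurvNonzero →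
      L.IsTwoConcircularlyRecurrent) ∧
    L.IsGeneralizedRicciRecurrent ∧
    (L.CurvHatZero → L.ScalarCurvNonzero → L.IsRecurrent) := by
  exact ⟨fun hA hB => hAB.isGeneralizedTwoRecurrent hA hB,
    fun hC _ => hAB.isConcircularlyRecurrent hn hC,
    fun hC hA _ => hAB.isTwoConcircularlyRecurrent hn hC hA,
    hAB.isGeneralizedRicciRecurrent hn,
    fun hR _ => hAB.isRecurrent hn hR⟩
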